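/- **Setting.** Let $K$ be a non-archimedean local field of residue characteristic $p\neq 2$, and let $\nu\colon\overline K\to\mathbb Q\cup\{\infty\}$ be the extension of its valuation to $\overline K$, normalised so that uniformisers of $K$ have valuation $1$. Labels are $\mathtt A,\dots,\mathtt H$, and $P$ is the set of the $70$ four-element sets of labels. A *valuation data* is a vector $v=(w,v_\dagger)\in\mathbb Q^P\times\mathbb Q$; sums and maxima are componentwise. An *octad* is an $8$-tuple $O=(O_{\mathtt A},\dots,O_{\mathtt H})$ of points of $\mathbb P^3(\overline K)$; it is a *Cayley octad* if the eight points are distinct and are exactly the common points of three quadrics. Choose affine representatives whose coordinates have minimal valuation $0$. The octad has valuation data $v$ if $\nu(p_{ijkl})=v_{\{i,j,k,l\}}$ for all distinct $i,j,k,l$, where $p_{ijkl}=\det(O_i|O_j|O_k|O_l)$, and $v_\dagger$ is its twisted cubic index, i.e. the minimum of $\nu(t-t')-\min(\nu(t),\nu(t'))$ over all permutations of the labels in $$t=p_{\mathtt{ABCD}}\,p_{\mathtt{ABEF}}\,p_{\mathtt{ACEG}}\,p_{\mathtt{ADFG}},\qquad t'=p_{\mathtt{ABCE}}\,p_{\mathtt{ABDF}}\,p_{\mathtt{ACDG}}\,p_{\mathtt{AEFG}}.$$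 **Building blocks.** For a set $T$ of labels let $v_{\rm pt}^T,v_{\rm ln}^T,v_{\rm pln}^T$ have entries $\max(0,|S\cap T|-k)$ at $S\in P$, with $k=1,2,3$ respectively, and $\dagger$-entry $0$; let $v_{\rm tc}$ have entries $0$ on $P$ and $\dagger$-entry $1$. The building blocks are the following valuation data and all their relabellings: * $\alpha_{1a}^{AB}=v_{\rm pt}^{AB}$, $\alpha_{1b}^{AB}=v_{\rm pln}^{CDEFGH}$; * $\alpha_{2a}^{ABCD}=v_{\rm pln}^{ABCD}+v_{\rm pln}^{EFGH}$, $\alpha_{2b}^{ABCD}=v_{\rm pln}^{ABCD}+v_{\rm pt}^{ABCD}$; * $\chi_{1a}^{AB|CDE|FGH}=\max(v_{\rm ln}^{CDE}+v_{\rm ln}^{FGH},v_{\rm pln}^{CDEFGH})$, $\chi_{1b}^{AB|CDE|FGH}=\max(v_{\rm pt}^{AB},v_{\rm pln}^{ABCDE}+v_{\rm pln}^{ABFGH})$, $\chi_{1c}^{AB|CDE|FGH}=\max(v_{\rm ln}^{ABCDE}+v_{\rm ln}^{CDE},v_{\rm pt}^{CDE})$; * $\chi_{2a}^{ABC}=v_{\rm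 ln}^{DEFGH}+v_{\rm pln}^{DEFGH}$, $\chi_{2b}^{ABC}=v_{\rm ln}^{ABC}+v_{\rm pt}^{ABC}$, $\chi_{2c}^{ABC}=v_{\rm ln}^{ABC}+v_{\rm pln}^{DEFGH}$; * $\phi_{1a}^{AB|CD\|EF|GH}=v_{\rm ln}^{ABEF}+v_{\rm ln}^{ABGH}+v_{\rm pln}^{ABCD}+v_{\rm pln}^{EFGH}$, $\phi_{1b}^{AB|CD\|EF|GH}=\max(v_{\rm pt}^{AB}+v_{\rm pt}^{CD},v_{\rm pln}^{ABCDEF}+v_{\rm pln}^{ABCDGH})$; * $\phi_{2a}^{ABC|FGH}=\max(v_{\rm ln}^{ABC}+v_{\rm ln}^{FGH},v_{\rm pln}^{ABCDE}+v_{\rm pln}^{DEFGH})$, $\phi_{2b}^{ABC|FGH}=v_{\rm pt}^{DE}+v_{\rm ln}^{ABCD}+v_{\rm ln}^{ABCE}$, $\phi_{2c}^{ABC|FGH}=v_{\rm ln}^{ABCD}+v_{\rm ln}^{ABCE}+v_{\rm pln}^{ABCFGH}$; * $\phi_{3a}^{ABCD}=v_{\rm ln}^{ABCD}+v_{\rm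 pln}^{ABCD}+v_{\rm pln}^{EFGH}$, $\phi_{3b}^{ABCD}=v_{\rm pt}^{ABCD}+v_{\rm ln}^{ABCD}+v_{\rm pln}^{ABCD}$; * the hyperelliptic blocks ${\bf TCu}=v_{\rm tc}$ and ${\bf Line}^{ABCD}=v_{\rm ln}^{ABCD}$. The *picture* of a block is its family ($\alpha_1,\alpha_2,\chi_1,\chi_2,\phi_1,\phi_2,\phi_3,{\bf TCu},{\bf Line}$) with the labelling up to the following identifications: for $\alpha_2,\phi_3,{\bf Line}$ the quadruple may be replaced by its complement; for $\chi_1$ and $\phi_2$ the two triples may be exchanged; for $\phi_1$ the two pairs on either side of $\|$, and the two sides, may be exchanged. Sets of labels are unordered throughout. **Compatibility.** Two blocks are compatible if they have the same picture or if, up to order and a common relabelling, their pictures are one of $\alpha_1^{AB}\,\alpha_1^{CD}$; $\alpha_1^{AB}\,\alpha_2^{ABCD}$; $\alpha_2^{ABCD}\,\alpha_2^{ABEF}$; $\alpha_1^{AB}\,\chi_1^{AB|CDE|FGH}$; $\alpha_1^{CD}\,\chi_1^{AB|CDE|FGH}$; $\alpha_1^{AB}\,\chi_2^{ABC}$; $\alpha_1^{DE}\,\chi_2^{ABC}$;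 $\alpha_2^{ABCD}\,\chi_1^{AB|CEF|DGH}$; $\alpha_2^{ACDE}\,\chi_1^{AB|CDE|FGH}$; $\alpha_2^{ABCD}\,\chi_2^{ABC}$; $\chi_1^{AB|CDE|FGH}\,\chi_1^{GH|ABC|DEF}$; $\chi_1^{AB|CDE|FGH}\,\chi_2^{CDE}$; $\chi_2^{ABC}\,\chi_2^{DEF}$; $\phi_1^{AB|CD\|EF|GH}\,\alpha_1^{AB}$; $\phi_1^{AB|CD\|EF|GH}\,\alpha_2^{ACEF}$; $\phi_2^{ABC|FGH}\,\alpha_1^{AB}$; $\phi_2^{ABC|FGH}\,\alpha_2^{ABDE}$; $\phi_3^{ABCD}\,\alpha_1^{AB}$; $\phi_1^{AB|CD\|EF|GH}\,\chi_1^{AB|CEF|DGH}$; $\phi_2^{ABC|FGH}\,\chi_1^{AB|CDE|FGH}$; $\phi_2^{ABC|FGH}\,\chi_2^{ABC}$; $\phi_3^{ABCD}\,\chi_2^{ABC}$; ${\bf TCu}\,\alpha_1^{AB}$; ${\bf Line}^{ABCD}\,\alpha_1^{AB}$; ${\bf Line}^{ABCD}\,\alpha_2^{ABCE}$; ${\bf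 TCu}\,\chi_2^{ABC}$; ${\bf Line}^{ABCD}\,\chi_1^{AB|CDE|FGH}$; ${\bf Line}^{ABCD}\,\chi_2^{ABC}$. The *auxiliary blocks* of a $\phi$-block are the blocks with the following pictures (up to a common relabelling): for $\phi_1^{AB|CD\|EF|GH}$: $\alpha_2^{ABCD}$, ${\bf Line}^{ABEF}$, ${\bf Line}^{ABGH}$, ${\bf Line}^{CDEF}$, ${\bf Line}^{CDGH}$; for $\phi_2^{ABC|FGH}$: $\alpha_1^{DE}$, ${\bf Line}^{ABCD}$, ${\bf Line}^{ABCE}$, ${\bf Line}^{DFGH}$, ${\bf Line}^{EFGH}$; for $\phi_3^{ABCD}$: $\alpha_2^{ABCD}$, ${\bf TCu}$, ${\bf Line}^{ABCD}$, ${\bf Line}^{EFGH}$. A *compatible block decomposition* of $v$ is an expression $v=\sum_i m_iB_i+\sum_j l_jb_j$ (finite sums) with rational $m_i>0$ and $l_j\ge 0$, pairwise compatible building blocks $B_i$, and auxiliary blocks $b_j$ of $\phi$-blocks among the $B_i$, all the $b_j$ having the same picture. **Equivalence.** Two valuation data $v,v'$ are $\mathrm{PGL}_3(\overline K)$-equivalent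 if $v_\dagger=v'_\dagger$, and every octad whose Plücker valuations are those of $v$ can be moved by an element of $\mathrm{PGL}_3(\overline K)$ to one whose Plücker valuations are those of $v'$, and conversely. **Theorem.** Let $O$ be a Cayley octad with valuation data $v$ over a non-archimedean local field $K$ of residue characteristic $p\ne2$. If $v$ admits a compatible block decomposition, then it is unique up to $\mathrm{PGL}_3(\overline K)$-equivalence: for any two compatible block decompositions of $v$ and every $\mathrm{PGL}_3(\overline K)$-equivalence class of building blocks, the sum of the coefficients $m_i$ of the blocks $B_i$ in this class is the same in both, and so is the sum of the coefficients $l_j$ of the auxiliary blocks $b_j$ in this class. -/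

import Mathlib

open scoped ValuativeRel LinearAlgebra.Projectivization

noncomputable section

namespace CayleyOctad

/-! ### Valuation data

The eight labels `A, B, C, D, E, F, G, H` are the elements `0, 1, …, 7` of `Fin 8`. -/

/-- The set `P` of the 70 four-element subsets of the eight labels. -/
abbrev Quad : Type := {S : Finset (Fin 8) // S.card = 4}

/-- A valuation data `v : P ∪ {†} → ℚ`, written as a pair `(w, t)` with `w ∈ ℚ^P` and
`t = v_†`. Sums, rational multiples and maxima `⊔` are componentwise. -/
abbrev ValData : Type := (Quad → ℚ) × ℚ

/-- The point coincidence vector `v_pt^T`. -/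
def vpt (T : Finset (Fin 8)) : ValData := (fun S => max 0 (((S.1 ∩ T).card : ℚ) - 1), 0)

/-- The line coincidence vector `v_ln^T`. -/
def vln (T : Finset (Fin 8)) : ValData := (fun S => max 0 (((S.1 ∩ T).card : ℚ) - 2), 0)

/-- The plane coincidence vector `v_pln^T`. -/
def vpln (T : Finset (Fin 8)) : ValData := (fun S => max 0 (((S.1 ∩ T).card : ℚ) - 3), 0)

/-- The twisted cubic coincidence vector `v_tc`. -/
def vtc : ValData := (0, 1)

/-- Relabelling of valuation data: the label `i` is renamed `σ i`. -/
def relabel (σ : Equiv.Perm (Fin 8)) (v : ValData) : ValData :=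
  (fun S => v.1 ⟨S.1.map σ.symm.toEmbedding, by rw [Finset.card_map, S.2]⟩, v.2)

/-! ### Building blocks and their pictures -/

/-- The nine families of building blocks. -/
inductive Family
  | alpha1 | alpha2 | chi1 | chi2 | phi1 | phi2 | phi3 | tcu | line
  deriving DecidableEq

/-- The 19 building blocks up to relabelling. -/
inductive Kind
  | alpha1a | alpha1b
  | alpha2a | alpha2b
  | chi1a | chi1b | chi1c
  | chi2a | chi2b | chi2c
  | phi1a | phi1b
  | phi2a | phi2b | phi2c
  | phi3a | phi3b
  | tcu
  | line
  deriving DecidableEq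

/-- The family of a kind of block (forget the letter a, b, c). -/
def Kind.family : Kind → Family
  | .alpha1a | .alpha1b => .alpha1
  | .alpha2a | .alpha2b => .alpha2
  | .chi1a | .chi1b | .chi1c => .chi1
  | .chi2a | .chi2b | .chi2c => .chi2
  | .phi1a | .phi1b => .phi1
  | .phi2a | .phi2b | .phi2c => .phi2
  | .phi3a | .phi3b => .phi3
  | .tcu => .tcu
  | .line => .line

/-- The 19 building blocks in their standard labelling: `α₁^{AB}`, `α₂^{ABCD}`,
`χ₁^{AB|CDE|FGH}`, `χ₂^{ABC}`, `φ₁^{AB|CD‖EF|GH}`, `φ₂^{ABC|FGH}`, `φ₃^{ABCD}`, `TCu`,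
`Line^{ABCD}`. -/
def Kind.std : Kind → ValData
  | .alpha1a => vpt {0, 1}
  | .alpha1b => vpln {2, 3, 4, 5, 6, 7}
  | .alpha2a => vpln {0, 1, 2, 3} + vpln {4, 5, 6, 7}
  | .alpha2b => vpln {0, 1, 2, 3} + vpt {0, 1, 2, 3}
  | .chi1a => (vln {2, 3, 4} + vln {5, 6, 7}) ⊔ vpln {2, 3, 4, 5, 6, 7}
  | .chi1b => vpt {0, 1} ⊔ (vpln {0, 1, 2, 3, 4} + vpln {0, 1, 5, 6, 7})
  | .chi1c => (vln {0, 1, 2, 3, 4} + vln {2, 3, 4}) ⊔ vpt {2, 3, 4}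
  | .chi2a => vln {3, 4, 5, 6, 7} + vpln {3, 4, 5, 6, 7}
  | .chi2b => vln {0, 1, 2} + vpt {0, 1, 2}
  | .chi2c => vln {0, 1, 2} + vpln {3, 4, 5, 6, 7}
  | .phi1a => vln {0, 1, 4, 5} + vln {0, 1, 6, 7} + vpln {0, 1, 2, 3} + vpln {4, 5, 6, 7}
  | .phi1b => (vpt {0, 1} + vpt {2, 3}) ⊔ (vpln {0, 1, 2, 3, 4, 5} + vpln {0, 1, 2, 3, 6, 7})
  | .phi2a => (vln {0, 1, 2} + vln {5, 6, 7}) ⊔ (vpln {0, 1, 2, 3, 4} + vpln {3, 4, 5, 6, 7})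
  | .phi2b => vpt {3, 4} + vln {0, 1, 2, 3} + vln {0, 1, 2, 4}
  | .phi2c => vln {0, 1, 2, 3} + vln {0, 1, 2, 4} + vpln {0, 1, 2, 5, 6, 7}
  | .phi3a => vln {0, 1, 2, 3} + vpln {0, 1, 2, 3} + vpln {4, 5, 6, 7}
  | .phi3b => vpt {0, 1, 2, 3} + vln {0, 1, 2, 3} + vpln {0, 1, 2, 3}
  | .tcu => vtc
  | .line => vln {0, 1, 2, 3}

/-- A (labelled) octad picture of a single block: its family together with the collection of
sets of labels that are marked in the picture. Two pictures are the same picture exactly when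
they are equal as terms of this type. -/
abbrev Picture : Type := Family × Finset (Finset (Fin 8))

/-- Relabelling of pictures. -/
def Picture.relabel (σ : Equiv.Perm (Fin 8)) (P : Picture) : Picture :=
  (P.1, P.2.image (fun T => T.map σ.toEmbedding))

/-- `α₁^{T}` marks the pair `T`. -/
def picAlpha1 (T : Finset (Fin 8)) : Picture := (.alpha1, {T})

/-- `α₂^{T}` marks the partition of the labels into the quadruple `T` and its complement. -/
def picAlpha2 (T : Finset (Fin 8)) : Picture := (.alpha2, {T, Tᶜ})

/-- `χ₁^{T|U|V}` marks the pair `T` and, without order, the two triples `U`, `V`. -/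
def picChi1 (T U V : Finset (Fin 8)) : Picture := (.chi1, {T, U, V})

/-- `χ₂^{T}` marks the triple `T`. -/
def picChi2 (T : Finset (Fin 8)) : Picture := (.chi2, {T})

/-- `φ₁^{T|U‖V|W}` marks the partition of the labels into the pairs `T`, `U`, `V`, `W`,
and the partition into the two quadruples `T ∪ U`, `V ∪ W`. -/
def picPhi1 (T U V W : Finset (Fin 8)) : Picture := (.phi1, {T, U, V, W, T ∪ U, V ∪ W})

/-- `φ₂^{T|U}` marks, without order, the triples `T`, `U`, and the remaining pair. -/
def picPhi2 (T U : Finset (Fin 8)) : Picture := (.phi2, {T, U, (T ∪ U)ᶜ})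

/-- `φ₃^{T}` marks the partition of the labels into the quadruple `T` and its complement. -/
def picPhi3 (T : Finset (Fin 8)) : Picture := (.phi3, {T, Tᶜ})

/-- The picture of the block `TCu`. -/
def picTCu : Picture := (.tcu, ∅)

/-- `Line^{T}` marks the partition of the labels into the quadruple `T` and its complement. -/
def picLine (T : Finset (Fin 8)) : Picture := (.line, {T, Tᶜ})

/-- The picture of each family in the standard labelling. -/
def Family.stdPicture : Family → Picture
  | .alpha1 => picAlpha1 {0, 1}
  | .alpha2 => picAlpha2 {0, 1, 2, 3}
  | .chi1 => picChi1 {0, 1} {2, 3, 4} {5, 6, 7}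
  | .chi2 => picChi2 {0, 1, 2}
  | .phi1 => picPhi1 {0, 1} {2, 3} {4, 5} {6, 7}
  | .phi2 => picPhi2 {0, 1, 2} {5, 6, 7}
  | .phi3 => picPhi3 {0, 1, 2, 3}
  | .tcu => picTCu
  | .line => picLine {0, 1, 2, 3}

/-- A building block: one of the 19 kinds, with the labels `A, …, H` of its standard form renamed
`label A, …, label H`. -/
structure Block where
  kind : Kind
  label : Equiv.Perm (Fin 8)
  deriving DecidableEq

/-- The valuation data that a building block is. -/
def Block.val (B : Block) : ValData := relabel B.label B.kind.std

/-- The picture of a building block. -/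
def Block.picture (B : Block) : Picture := Picture.relabel B.label B.kind.family.stdPicture

/-! ### Compatibility and auxiliary blocks -/

/-- The table of the pictures of any two compatible blocks (up to relabelling). -/
def compatTable : List (Picture × Picture) :=
  [ -- two alpha-blocks
    (picAlpha1 {0, 1}, picAlpha1 {2, 3}),
    (picAlpha1 {0, 1}, picAlpha2 {0, 1, 2, 3}),
    (picAlpha2 {0, 1, 2, 3}, picAlpha2 {0, 1, 4, 5}),
    -- an alpha-block and a chi-block
    (picAlpha1 {0, 1}, picChi1 {0, 1} {2, 3, 4} {5, 6, 7}),
    (picAlpha1 {2, 3}, picChi1 {0, 1} {2, 3, 4} {5, 6, 7}),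
    (picAlpha1 {0, 1}, picChi2 {0, 1, 2}),
    (picAlpha1 {3, 4}, picChi2 {0, 1, 2}),
    (picAlpha2 {0, 1, 2, 3}, picChi1 {0, 1} {2, 4, 5} {3, 6, 7}),
    (picAlpha2 {0, 2, 3, 4}, picChi1 {0, 1} {2, 3, 4} {5, 6, 7}),
    (picAlpha2 {0, 1, 2, 3}, picChi2 {0, 1, 2}),
    -- two chi-blocks
    (picChi1 {0, 1} {2, 3, 4} {5, 6, 7}, picChi1 {6, 7} {0, 1, 2} {3, 4, 5}),
    (picChi1 {0, 1} {2, 3, 4} {5, 6, 7}, picChi2 {2, 3, 4}),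
    (picChi2 {0, 1, 2}, picChi2 {3, 4, 5}),
    -- a phi-block and an alpha-block
    (picPhi1 {0, 1} {2, 3} {4, 5} {6, 7}, picAlpha1 {0, 1}),
    (picPhi1 {0, 1} {2, 3} {4, 5} {6, 7}, picAlpha2 {0, 2, 4, 5}),
    (picPhi2 {0, 1, 2} {5, 6, 7}, picAlpha1 {0, 1}),
    (picPhi2 {0, 1, 2} {5, 6, 7}, picAlpha2 {0, 1, 3, 4}),
    (picPhi3 {0, 1, 2, 3}, picAlpha1 {0, 1}),
    -- a phi-block and a chi-block
    (picPhi1 {0, 1} {2, 3} {4, 5} {6, 7}, picChi1 {0, 1} {2, 4, 5} {3, 6, 7}),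
    (picPhi2 {0, 1, 2} {5, 6, 7}, picChi1 {0, 1} {2, 3, 4} {5, 6, 7}),
    (picPhi2 {0, 1, 2} {5, 6, 7}, picChi2 {0, 1, 2}),
    (picPhi3 {0, 1, 2, 3}, picChi2 {0, 1, 2}),
    -- a hyperelliptic block and an alpha-block
    (picTCu, picAlpha1 {0, 1}),
    (picLine {0, 1, 2, 3}, picAlpha1 {0, 1}),
    (picLine {0, 1, 2, 3}, picAlpha2 {0, 1, 2, 4}),
    -- a hyperelliptic block and a chi-block
    (picTCu, picChi2 {0, 1, 2}),
    (picLine {0, 1, 2, 3}, picChi1 {0, 1} {2, 3, 4} {5, 6, 7}),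
    (picLine {0, 1, 2, 3}, picChi2 {0, 1, 2}) ]

/-- Two pictures are compatible if they are equal or if, in some order and up to a common
relabelling, they form an entry of the table. -/
def CompatiblePictures (P Q : Picture) : Prop :=
  P = Q ∨ ∃ σ : Equiv.Perm (Fin 8), ∃ e ∈ compatTable,
    (P = e.1.relabel σ ∧ Q = e.2.relabel σ) ∨ (Q = e.1.relabel σ ∧ P = e.2.relabel σ)

/-- The table of `φ`-blocks and their auxiliary blocks (up to relabelling). -/
def auxTable : List (Picture × Picture) :=
  [ (picPhi1 {0, 1} {2, 3} {4, 5} {6, 7}, picAlpha2 {0, 1, 2, 3}),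
    (picPhi1 {0, 1} {2, 3} {4, 5} {6, 7}, picLine {0, 1, 4, 5}),
    (picPhi1 {0, 1} {2, 3} {4, 5} {6, 7}, picLine {0, 1, 6, 7}),
    (picPhi1 {0, 1} {2, 3} {4, 5} {6, 7}, picLine {2, 3, 4, 5}),
    (picPhi1 {0, 1} {2, 3} {4, 5} {6, 7}, picLine {2, 3, 6, 7}),
    (picPhi2 {0, 1, 2} {5, 6, 7}, picAlpha1 {3, 4}),
    (picPhi2 {0, 1, 2} {5, 6, 7}, picLine {0, 1, 2, 3}),
    (picPhi2 {0, 1, 2} {5, 6, 7}, picLine {0, 1, 2, 4}),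
    (picPhi2 {0, 1, 2} {5, 6, 7}, picLine {3, 5, 6, 7}),
    (picPhi2 {0, 1, 2} {5, 6, 7}, picLine {4, 5, 6, 7}),
    (picPhi3 {0, 1, 2, 3}, picAlpha2 {0, 1, 2, 3}),
    (picPhi3 {0, 1, 2, 3}, picTCu),
    (picPhi3 {0, 1, 2, 3}, picLine {0, 1, 2, 3}),
    (picPhi3 {0, 1, 2, 3}, picLine {4, 5, 6, 7}) ]

/-- `Q` is the picture of an auxiliary block of a `φ`-block with picture `P`. -/
def IsAuxiliaryTo (Q P : Picture) : Prop :=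
  ∃ σ : Equiv.Perm (Fin 8), ∃ e ∈ auxTable, P = e.1.relabel σ ∧ Q = e.2.relabel σ

/-- `v = ∑ m_B B + ∑ l_b b` is a block decomposition of `v`: the `B` in the support of `m`
are the building blocks of the decomposition (with positive coefficients), the `b` in the support
of `l` are auxiliary blocks of the `φ`-blocks among them, all with the same picture. -/
structure IsBlockDecomposition (v : ValData) (m l : Block →₀ ℚ) : Prop where
  main_nonneg : ∀ B, 0 ≤ m B
  aux_nonneg : ∀ b, 0 ≤ l b
  isAuxiliary : ∀ b ∈ l.support, ∃ B ∈ m.support, IsAuxiliaryTo b.picture B.picture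
  aux_samePicture : ∀ b ∈ l.support, ∀ b' ∈ l.support, b.picture = b'.picture
  eq_sum : v = (m.sum fun B c => c • B.val) + l.sum fun b c => c • b.val

/-- A block decomposition is compatible if its blocks, auxiliary blocks excluded, are pairwise
compatible. -/
structure IsCompatibleBlockDecomposition (v : ValData) (m l : Block →₀ ℚ) : Prop
    extends IsBlockDecomposition v m l where
  compatible : ∀ B ∈ m.support, ∀ B' ∈ m.support, CompatiblePictures B.picture B'.picture

/-! ### Octads over a valued field -/

section Octads

variable {L : Type*} [Field L]

/-- Eight-tuples of points of projective 3-space over `L`. -/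
abbrev Octad (L : Type*) [Field L] : Type _ := Fin 8 → ℙ L (Fin 4 → L)

/-- A Cayley octad: eight points which are the common points of three quadrics. -/
def IsCayleyOctad (O : Octad L) : Prop :=
  Function.Injective O ∧
    ∃ q : Fin 3 → QuadraticForm L (Fin 4 → L),
      ∀ X : ℙ L (Fin 4 → L), X ∈ Set.range O ↔ ∀ i, q i X.rep = 0

/-- `x` is a system of affine representatives of the points of `O`, normalised so that for each
point the minimum of the valuations of its coordinates is `0`. -/
structure IsNormalizedLift (ν : AddValuation L (WithTop ℚ)) (O : Octad L)
    (x : Fin 8 → Fin 4 → L) : Prop where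
  lift : ∀ i, ∃ h : x i ≠ 0, Projectivization.mk L (x i) h = O i
  normalized : ∀ i, (Finset.univ.inf fun j => ν (x i j)) = 0

/-- The Plücker coordinate `det (x_i | x_j | x_k | x_l)`, where `e = (i, j, k, l)`. -/
def plucker (x : Fin 8 → Fin 4 → L) (e : Fin 4 → Fin 8) : L :=
  Matrix.det (Matrix.of fun r c => x (e c) r)

/-- `w` gives the valuations of the Plücker coordinates of `x`. -/
def HasPluckerValuations (ν : AddValuation L (WithTop ℚ)) (x : Fin 8 → Fin 4 → L)
    (w : Quad → ℚ) : Prop :=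
  ∀ e : Fin 4 ↪ Fin 8,
    ν (plucker x e) = (w ⟨Finset.univ.map e, by rw [Finset.card_map, Finset.card_fin]⟩ : ℚ)

/-- First term of the two-term polynomial, indexed by `σ`, which vanishes when the seven points
`σ 0, …, σ 6` lie on a twisted cubic: projected from the point `σ 0`, the points `σ 1, …, σ 6`
then lie on a conic. -/
def tcTerm (x : Fin 8 → Fin 4 → L) (σ : Equiv.Perm (Fin 8)) : L :=
  plucker x ![σ 0, σ 1, σ 2, σ 3] * plucker x ![σ 0, σ 1, σ 4, σ 5] *
    plucker x ![σ 0, σ 2, σ 4, σ 6] * plucker x ![σ 0, σ 3, σ 5, σ 6]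

/-- Second term of this polynomial. -/
def tcTerm' (x : Fin 8 → Fin 4 → L) (σ : Equiv.Perm (Fin 8)) : L :=
  plucker x ![σ 0, σ 1, σ 2, σ 4] * plucker x ![σ 0, σ 1, σ 3, σ 5] *
    plucker x ![σ 0, σ 2, σ 3, σ 6] * plucker x ![σ 0, σ 4, σ 5, σ 6]

/-- `t` is the twisted cubic index: the minimum over all `σ` of the gap between the valuation of
`tcTerm x σ - tcTerm' x σ` and the generic value of this valuation for the given valuations of
the Plücker coordinates, which is the minimum of the valuations of the two terms. -/
def IsTwistedCubicIndex (ν : AddValuation L (WithTop ℚ)) (x : Fin 8 → Fin 4 → L) (t : ℚ) : Prop :=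
  (∀ σ, (t : WithTop ℚ) + min (ν (tcTerm x σ)) (ν (tcTerm' x σ)) ≤
      ν (tcTerm x σ - tcTerm' x σ)) ∧
    ∃ σ, (t : WithTop ℚ) + min (ν (tcTerm x σ)) (ν (tcTerm' x σ)) =
      ν (tcTerm x σ - tcTerm' x σ)

/-- `v` is the valuation data of the octad `O`. -/
def IsValuationData (ν : AddValuation L (WithTop ℚ)) (O : Octad L) (v : ValData) : Prop :=
  ∃ x, IsNormalizedLift ν O x ∧ HasPluckerValuations ν x v.1 ∧ IsTwistedCubicIndex ν x v.2

/-- `w` is the Plücker part of the valuation data of the octad `O`. -/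
def IsPluckerData (ν : AddValuation L (WithTop ℚ)) (O : Octad L) (w : Quad → ℚ) : Prop :=
  ∃ x, IsNormalizedLift ν O x ∧ HasPluckerValuations ν x w

/-- Equivalence of valuation data under `PGL₃`: every octad with Plücker valuations `v` can be
moved by a projective transformation of `ℙ³` to one with Plücker valuations `v'`, and conversely;
the twisted cubic index, which projective transformations do not change, is the same. -/
def PGLEquivalent (ν : AddValuation L (WithTop ℚ)) (v v' : ValData) : Prop :=
  v.2 = v'.2 ∧
    (∀ O : Octad L, IsPluckerData ν O v.1 →
      ∃ g : LinearMap.GeneralLinearGroup L (Fin 4 → L), IsPluckerData ν (fun i => g • O i) v'.1) ∧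
    (∀ O : Octad L, IsPluckerData ν O v'.1 →
      ∃ g : LinearMap.GeneralLinearGroup L (Fin 4 → L), IsPluckerData ν (fun i => g • O i) v.1)

open scoped Classical in
/-- The total coefficient in `f` of the blocks that are `PGL₃`-equivalent to `B`. -/
def classCoeff (ν : AddValuation L (WithTop ℚ)) (f : Block →₀ ℚ) (B : Block) : ℚ :=
  ∑ B' ∈ f.support with PGLEquivalent ν B'.val B.val, f B'

/-- Two block decompositions agree up to `PGL₃`-equivalence: each equivalence class of
building blocks occurs in both with the same total coefficient, among the proper blocks as well as
among the auxiliary blocks. -/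
def DecompositionsEquivalent (ν : AddValuation L (WithTop ℚ)) (m l m' l' : Block →₀ ℚ) : Prop :=
  ∀ B : Block, classCoeff ν m B = classCoeff ν m' B ∧ classCoeff ν l B = classCoeff ν l' B

end Octads

/-- `ν` is the valuation on the algebraic closure of the local field `K` which extends the
valuation of `K`, normalised with respect to `K` (uniformisers of `K` have valuation `1`). -/
structure IsNormalizedValuation (K : Type*) [Field K] [ValuativeRel K] [TopologicalSpace K]
    [IsNonarchimedeanLocalField K] (ν : AddValuation (AlgebraicClosure K) (WithTop ℚ)) : Prop where
  extends_valuation : ∀ a : K,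
    0 ≤ ν (algebraMap K (AlgebraicClosure K) a) ↔ ValuativeRel.valuation K a ≤ 1
  uniformizer : ∀ ϖ : 𝒪[K], Irreducible ϖ → ν (algebraMap K (AlgebraicClosure K) (ϖ : K)) = 1

end CayleyOctad

end

open CayleyOctad

noncomputable section

namespace CayleyOctad

/-! ### Invariants of pictures under relabelling -/

theorem Block.picture_fst (B : Block) : B.picture.1 = B.kind.family := by
  obtain ⟨k, σ⟩ := B
  cases k <;> rfl

/-- A pairing of collections of sets of labels that is invariant under relabelling. -/
def pairing (A B : Finset (Finset (Fin 8))) : ℕ :=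
  ∑ S ∈ A, ∑ T ∈ B, S.card * T.card * (S ∩ T).card ^ 2

/-- The function of families with the given values. -/
def Family.table {α : Type} (a₁ a₂ c₁ c₂ p₁ p₂ p₃ t l : α) (f : Family) : α :=
  Family.rec (motive := fun _ => α) a₁ a₂ c₁ c₂ p₁ p₂ p₃ t l f

/-- The value of `k` at the numeral to which `n` evaluates. -/
def withNumeral (n : ℕ) (k : ℕ → ℕ) : ℕ :=
  Nat.rec (motive := fun _ => ℕ) (k 0) (fun m _ => k m.succ) n

theorem withNumeral_eq (n : ℕ) (k : ℕ → ℕ) : withNumeral n k = k n := by cases n <;> rfl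

/-- The doubled entry at `S` of a representative of a block modulo lineality, in terms of the
pairing of its picture with `S`. -/
def entryOfPairing (f : Family) (n : ℕ) : ℕ :=
  -- The constants are values of `pairing` of a picture of the family with a quadruple; values not
  -- listed give entry 0. Entries are doubled because the symmetric representatives of the φ-blocks
  -- and of Line have half-integral entries.
  withNumeral n <| f.table
    (fun k => bif k.beq 32 then 2 else 0)
    (fun k => bif k.beq 256 then 2 else 0)
    (fun k => bif k.beq 116 then 2 else bif k.beq 120 then 2 else bif k.beq 96 then 2 else 0)
    (fun k => bif k.beq 12 then 2 else bif k.beq 0 then 6 else 0)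
    (fun k => bif k.beq 176 then 2 else bif k.beq 208 then 1 else bif k.beq 192 then 2 else
      bif k.beq 320 then 2 else 0)
    (fun k => bif k.beq 68 then 1 else bif k.beq 120 then 2 else bif k.beq 56 then 2 else
      bif k.beq 116 then 3 else bif k.beq 80 then 4 else 0)
    (fun k => bif k.beq 256 then 4 else bif k.beq 160 then 1 else 0)
    (fun _ => 0)
    (fun k => bif k.beq 256 then 2 else bif k.beq 160 then 1 else 0)

/-- The doubled entry at `S` of the symmetric representative of the blocks with picture `P`. -/
def entry (P : Picture) (S : Finset (Fin 8)) : ℕ := entryOfPairing P.1 (pairing P.2 {S})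

theorem pairing_comm (A B : Finset (Finset (Fin 8))) : pairing A B = pairing B A := by
  unfold pairing
  rw [Finset.sum_comm]
  refine Finset.sum_congr rfl fun S _ => Finset.sum_congr rfl fun T _ => ?_
  rw [Finset.inter_comm, mul_comm T.card]

theorem pairing_image (σ : Equiv.Perm (Fin 8)) (A B : Finset (Finset (Fin 8))) :
    pairing (A.image fun T => T.map σ.toEmbedding) (B.image fun T => T.map σ.toEmbedding) =
      pairing A B := by
  have hinj : Function.Injective fun T : Finset (Fin 8) => T.map σ.toEmbedding :=
    Finset.map_injective _
  unfold pairing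
  rw [Finset.sum_image hinj.injOn]
  refine Finset.sum_congr rfl fun S _ => ?_
  rw [Finset.sum_image hinj.injOn]
  refine Finset.sum_congr rfl fun T _ => ?_
  rw [← Finset.map_inter, Finset.card_map, Finset.card_map, Finset.card_map]

theorem pairing_relabel (σ : Equiv.Perm (Fin 8)) (P Q : Picture) :
    pairing (P.relabel σ).2 (Q.relabel σ).2 = pairing P.2 Q.2 := pairing_image σ P.2 Q.2

theorem entry_relabel (σ : Equiv.Perm (Fin 8)) (P : Picture) (S : Finset (Fin 8)) :
    entry (P.relabel σ) (S.map σ.toEmbedding) = entry P S := by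
  have := pairing_image σ P.2 {S}
  rw [Finset.image_singleton] at this
  unfold entry
  rw [← this]
  rfl

theorem Picture.relabel_relabel (σ τ : Equiv.Perm (Fin 8)) (P : Picture) :
    (P.relabel σ).relabel τ = P.relabel (τ * σ) := by
  refine Prod.ext rfl ?_
  simp only [Picture.relabel, Finset.image_image]
  refine Finset.image_congr fun T _ => ?_
  simp only [Function.comp, Finset.map_map]
  rfl

theorem Picture.relabel_one (P : Picture) : P.relabel 1 = P := by
  refine Prod.ext rfl ?_
  simp only [Picture.relabel]
  conv_rhs => rw [← Finset.image_id (s := P.2)]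
  refine Finset.image_congr fun T _ => ?_
  exact Finset.map_refl

/-! ### Sets of labels as bit masks -/

/-- The set of labels whose bits are set in `m`. -/
def labelsOf (m : ℕ) : Finset (Fin 8) := Finset.univ.filter fun i => m.testBit i

/-- The number of bits set in `m < 256`, read off from a table of hexadecimal digits. -/
def bitCount (m : ℕ) : ℕ :=
  Nat.mod (Nat.shiftRight
    0x8776766576656554766565546554544376656554655454436554544354434332766565546554544365545443544343326554544354434332544343324332322176656554655454436554544354434332655454435443433254434332433232216554544354434332544343324332322154434332433232214332322132212110
    (Nat.mul 4 m)) 16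

theorem mem_labelsOf {m : ℕ} {i : Fin 8} : i ∈ labelsOf m ↔ m.testBit i = true := by
  simp [labelsOf]

theorem labelsOf_and (a b : ℕ) : labelsOf (a &&& b) = labelsOf a ∩ labelsOf b := by
  ext i; simp [mem_labelsOf, Nat.testBit_and]

theorem labelsOf_or (a b : ℕ) : labelsOf (a ||| b) = labelsOf a ∪ labelsOf b := by
  ext i; simp [mem_labelsOf, Nat.testBit_or]

theorem labelsOf_compl (a : ℕ) : labelsOf (255 ^^^ a) = (labelsOf a)ᶜ := by
  ext i
  have : Nat.testBit 255 i = true := by revert i; decide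
  rw [mem_labelsOf, Finset.mem_compl, mem_labelsOf, Nat.testBit_xor, this]
  simp

theorem labelsOf_pow (i : Fin 8) : labelsOf (2 ^ (i : ℕ)) = {i} := by
  ext j; simp [mem_labelsOf, Nat.testBit_two_pow, Fin.ext_iff, eq_comm]

theorem card_labelsOf {m : ℕ} (hm : m < 256) : (labelsOf m).card = bitCount m := by
  have : ∀ m < 256, (labelsOf m).card = bitCount m := by decide +kernel
  exact this m hm

theorem labelsOf_injOn {a b : ℕ} (ha : a < 256) (hb : b < 256) (h : labelsOf a = labelsOf b) :
    a = b := by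
  refine Nat.eq_of_testBit_eq fun i => ?_
  by_cases hi : i < 8
  · have : (⟨i, hi⟩ : Fin 8) ∈ labelsOf a ↔ (⟨i, hi⟩ : Fin 8) ∈ labelsOf b := by rw [h]
    rw [mem_labelsOf, mem_labelsOf] at this
    exact Bool.eq_iff_iff.2 this
  · have h8 : 2 ^ 8 ≤ 2 ^ i := Nat.pow_le_pow_right (by norm_num) (by omega)
    rw [Nat.testBit_lt_two_pow (by omega), Nat.testBit_lt_two_pow (by omega)]

/-- Counting: `labelsOf` is injective on the 256 masks, and there are 256 sets of labels. -/
theorem exists_labelsOf (T : Finset (Fin 8)) : ∃ m < 256, labelsOf m = T := by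
  have hinj : Set.InjOn labelsOf (Finset.range 256 : Set ℕ) := fun a ha b hb h =>
    labelsOf_injOn (by simpa using ha) (by simpa using hb) h
  have hcard : ((Finset.range 256).image labelsOf).card = Fintype.card (Finset (Fin 8)) := by
    rw [Finset.card_image_of_injOn hinj]; simp
  have := (Finset.card_eq_iff_eq_univ _).1 hcard
  have hT : T ∈ (Finset.range 256).image labelsOf := this ▸ Finset.mem_univ T
  obtain ⟨m, hm, rfl⟩ := Finset.mem_image.1 hT
  exact ⟨m, Finset.mem_range.1 hm, rfl⟩

/-- The sum of the values of `f` on a list. -/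
def listSum (f : ℕ → ℕ) (l : List ℕ) : ℕ :=
  List.rec (motive := fun _ => ℕ) 0 (fun a _ s => Nat.add (f a) s) l

theorem listSum_eq (f : ℕ → ℕ) (l : List ℕ) : listSum f l = (l.map f).sum := by
  induction l with
  | nil => rfl
  | cons a l ih => rw [List.map_cons, List.sum_cons, ← ih]; rfl

/-- The pairing in terms of lists of bit masks. -/
def maskPairing (a b : List ℕ) : ℕ :=
  listSum (fun s => withNumeral (bitCount s) fun p => listSum (fun t =>
    withNumeral (bitCount (Nat.land s t)) fun n =>
      Nat.mul (Nat.mul p (bitCount t)) (Nat.mul n n)) b) a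

/-- The collection of sets of labels encoded by a list of bit masks. -/
def setsOf (l : List ℕ) : Finset (Finset (Fin 8)) := (l.map labelsOf).toFinset

/-- A list of distinct bit masks of sets of labels. -/
def IsMaskList (l : List ℕ) : Prop := l.Nodup ∧ ∀ m ∈ l, m < 256

theorem sum_setsOf {l : List ℕ} (hl : IsMaskList l) (f : Finset (Fin 8) → ℕ) :
    ∑ S ∈ setsOf l, f S = listSum (fun m => f (labelsOf m)) l := by
  rw [setsOf, List.sum_toFinset, listSum_eq, List.map_map]
  · rfl
  · exact hl.1.map_on fun a ha b hb h => labelsOf_injOn (hl.2 a ha) (hl.2 b hb) h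

theorem listSum_congr {f g : ℕ → ℕ} {l : List ℕ} (h : ∀ m ∈ l, f m = g m) :
    listSum f l = listSum g l := by
  rw [listSum_eq, listSum_eq, List.map_congr_left h]

theorem pairing_setsOf {a b : List ℕ} (ha : IsMaskList a) (hb : IsMaskList b) :
    pairing (setsOf a) (setsOf b) = maskPairing a b := by
  unfold pairing maskPairing
  rw [sum_setsOf ha]
  refine listSum_congr fun s hs => ?_
  rw [sum_setsOf hb, withNumeral_eq]
  refine listSum_congr fun t ht => ?_
  rw [← labelsOf_and, card_labelsOf (ha.2 s hs), card_labelsOf (hb.2 t ht), card_labelsOf,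
    withNumeral_eq, sq]
  · rfl
  · exact lt_of_le_of_lt Nat.and_le_left (ha.2 s hs)

/-! ### Codes of pictures -/

/-- A code of a picture: the sets of labels are given by bit masks. -/
abbrev Code : Type := Family × List ℕ

/-- The picture with a given code. -/
def Code.picture (c : Code) : Picture := (c.1, setsOf c.2)

/-- The bit masks of the sets of `k` labels. -/
def masksOfCard (k : ℕ) : List ℕ := (List.range 256).filter fun m => (bitCount m).beq k

/-- The codes that mark a single set of `k` labels. -/
def singleCodes (f : Family) (k : ℕ) : List Code := (masksOfCard k).map fun t => (f, [t])

/-- The codes that mark a partition into two quadruples. -/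
def quadCodes (f : Family) : List Code :=
  ((masksOfCard 4).filter fun t => t.blt (255 ^^^ t)).map fun t => (f, [t, 255 ^^^ t])

/-- The codes that mark a pair and two triples. -/
def tripleCodes (f : Family) : List Code :=
  (masksOfCard 2).flatMap fun t =>
    ((masksOfCard 3).filter fun u => (t &&& u).beq 0 && u.blt (255 ^^^ (t ||| u))).map fun u =>
      (f, [t, u, 255 ^^^ (t ||| u)])

/-- The codes that mark a partition into pairs and a compatible one into quadruples. -/
def pairCodes (f : Family) : List Code :=
  (masksOfCard 2).flatMap fun t =>
    ((masksOfCard 2).filter fun u => (t &&& u).beq 0 && t.blt u).flatMap fun u =>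
      ((masksOfCard 2).filter fun v => ((t ||| u) &&& v).beq 0 && t.blt v &&
        v.blt (255 ^^^ ((t ||| u) ||| v))).map fun v =>
          (f, [t, u, v, 255 ^^^ ((t ||| u) ||| v), t ||| u, v ||| (255 ^^^ ((t ||| u) ||| v))])

/-- The codes of all pictures of building blocks. -/
def codes : List Code :=
  singleCodes .alpha1 2 ++ (quadCodes .alpha2 ++ (tripleCodes .chi1 ++ (singleCodes .chi2 3 ++
    (pairCodes .phi1 ++ (tripleCodes .phi2 ++ (quadCodes .phi3 ++ ((.tcu, []) ::
      quadCodes .line)))))))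

theorem blt_of_lt {a b : ℕ} (h : a < b) : a.blt b = true := by
  rw [Nat.blt_eq]; exact h

theorem codes_isMaskList : ∀ c ∈ codes, IsMaskList c.2 := by
  have : (codes.all fun c => decide c.2.Nodup && c.2.all fun m => m.blt 256) = true := by
    decide +kernel
  intro c hc
  have := List.all_eq_true.1 this c hc
  rw [Bool.and_eq_true, decide_eq_true_iff, List.all_eq_true] at this
  exact ⟨this.1, fun m hm => by simpa using this.2 m hm⟩

theorem mem_masksOfCard {m k : ℕ} (hm : m < 256) (h : (labelsOf m).card = k) :
    m ∈ masksOfCard k := by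
  rw [card_labelsOf hm] at h
  simpa [masksOfCard, hm] using h

theorem and_eq_zero_of_disjoint {a b : ℕ} (ha : a < 256)
    (h : Disjoint (labelsOf a) (labelsOf b)) : a &&& b = 0 := by
  refine labelsOf_injOn (lt_of_le_of_lt Nat.and_le_left ha) (by norm_num) ?_
  rw [labelsOf_and, Finset.disjoint_iff_inter_eq_empty.1 h]
  decide

theorem exists_singleCodes (f : Family) {T : Finset (Fin 8)} {k : ℕ} (hT : T.card = k) :
    ∃ c ∈ singleCodes f k, c.picture = (f, {T}) := by
  obtain ⟨t, ht, rfl⟩ := exists_labelsOf T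
  exact ⟨(f, [t]), List.mem_map_of_mem (mem_masksOfCard ht hT), rfl⟩

theorem labelsOf_ne {a b : ℕ} (h : Disjoint (labelsOf a) (labelsOf b))
    (hc : 0 < (labelsOf a).card) :
    a ≠ b := by
  rintro rfl
  rw [disjoint_self] at h
  rw [h] at hc
  exact absurd hc (by decide)

/-- A code lists the smaller of the two complementary masks first; exchanging a quadruple with its
complement does not change the picture. -/
theorem exists_quadCodes (f : Family) {T : Finset (Fin 8)} (hT : T.card = 4) :
    ∃ c ∈ quadCodes f, c.picture = (f, {T, Tᶜ}) := by
  obtain ⟨t, ht, rfl⟩ := exists_labelsOf T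
  have key : ∀ t : ℕ, t < 256 → (labelsOf t).card = 4 → t < 255 ^^^ t →
      ∃ c ∈ quadCodes f, c.picture = (f, {labelsOf t, (labelsOf t)ᶜ}) := by
    intro t ht hT h
    refine ⟨(f, [t, 255 ^^^ t]), List.mem_map_of_mem (List.mem_filter.2
      ⟨mem_masksOfCard ht hT, blt_of_lt h⟩), ?_⟩
    rw [← labelsOf_compl]; simp [Code.picture, setsOf]
  have hlt : 255 ^^^ t < 256 := Nat.xor_lt_two_pow (n := 8) (by norm_num) ht
  have hne : t ≠ 255 ^^^ t := labelsOf_ne (by rw [labelsOf_compl]; exact disjoint_compl_right)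
    (by omega)
  rcases lt_or_gt_of_ne hne with h | h
  · exact key t ht hT h
  · have hx : 255 ^^^ (255 ^^^ t) = t := by rw [← Nat.xor_assoc, Nat.xor_self, Nat.zero_xor]
    have := key (255 ^^^ t) hlt (by rw [labelsOf_compl, Finset.card_compl, hT]; rfl)
      (by rwa [hx])
    rwa [labelsOf_compl, compl_compl, Finset.pair_comm] at this

theorem exists_tripleCodes (f : Family) {T U : Finset (Fin 8)} (hT : T.card = 2) (hU : U.card = 3)
    (hTU : Disjoint T U) :
    ∃ c ∈ tripleCodes f, c.picture = (f, {T, U, (T ∪ U)ᶜ}) := by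
  have key : ∀ t u : ℕ, t < 256 → u < 256 → (labelsOf t).card = 2 → (labelsOf u).card = 3 →
      Disjoint (labelsOf t) (labelsOf u) → u < 255 ^^^ (t ||| u) →
      ∃ c ∈ tripleCodes f,
        c.picture = (f, {labelsOf t, labelsOf u, (labelsOf t ∪ labelsOf u)ᶜ}) := by
    intro t u ht hu hT hU hd h
    refine ⟨(f, [t, u, 255 ^^^ (t ||| u)]), List.mem_flatMap.2 ⟨t, mem_masksOfCard ht hT,
      List.mem_map.2 ⟨u, List.mem_filter.2 ⟨mem_masksOfCard hu hU, ?_⟩, rfl⟩⟩, ?_⟩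
    · rw [and_eq_zero_of_disjoint ht hd, blt_of_lt h]; rfl
    · rw [← labelsOf_or, ← labelsOf_compl]; simp [Code.picture, setsOf]
  obtain ⟨t, ht, rfl⟩ := exists_labelsOf T
  obtain ⟨u, hu, rfl⟩ := exists_labelsOf U
  have hV : (labelsOf t ∪ labelsOf u)ᶜ.card = 3 := by
    rw [Finset.card_compl, Finset.card_union_of_disjoint hTU, hT, hU]; rfl
  have hor : t ||| u < 256 := Nat.or_lt_two_pow (n := 8) ht hu
  obtain ⟨v, hv, hvV⟩ : ∃ v < 256, labelsOf v = (labelsOf t ∪ labelsOf u)ᶜ :=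
    exists_labelsOf _
  have hv' : v = 255 ^^^ (t ||| u) := labelsOf_injOn hv
    (Nat.xor_lt_two_pow (n := 8) (by norm_num) hor) (by rw [hvV, labelsOf_compl, labelsOf_or])
  have hdU : Disjoint (labelsOf u) (labelsOf v) := by
    rw [hvV]; exact Disjoint.mono_left Finset.subset_union_right disjoint_compl_right
  have hdT : Disjoint (labelsOf t) (labelsOf v) := by
    rw [hvV]; exact Disjoint.mono_left Finset.subset_union_left disjoint_compl_right
  rcases lt_or_gt_of_ne (labelsOf_ne hdU (by omega)) with h | h
  · exact key t u ht hu hT hU hTU (hv' ▸ h)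
  -- The third set is the smaller triple here, so the two triples are exchanged.
  · have hu' : (labelsOf t ∪ labelsOf v)ᶜ = labelsOf u := by
      rw [hvV]
      ext i
      have hd := Finset.disjoint_left.1 hTU
      have := @hd i
      simp only [Finset.mem_compl, Finset.mem_union]
      grind
    have hu'' : u = 255 ^^^ (t ||| v) := labelsOf_injOn hu
      (Nat.xor_lt_two_pow (n := 8) (by norm_num) (Nat.or_lt_two_pow (n := 8) ht hv))
      (by rw [labelsOf_compl, labelsOf_or, hu'])
    have := key t v ht hv hT (hvV ▸ hV) hdT (hu'' ▸ h)
    rw [hu'] at this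
    rw [← hvV, Finset.pair_comm (labelsOf u)]
    exact this

/-- The symmetries of the picture are used to reach the normal form of the code: the pairs are
sorted within each side, and then the sides by their first pair. `key`, `key'` and `key''` drop the
three order assumptions one at a time. -/
theorem exists_pairCodes (f : Family) {T U V W : Finset (Fin 8)} (hT : T.card = 2)
    (hU : U.card = 2) (hV : V.card = 2) (hW : W.card = 2) (hTU : Disjoint T U)
    (hd : Disjoint (T ∪ U) V) (hWc : W = ((T ∪ U) ∪ V)ᶜ) :
    ∃ c ∈ pairCodes f, c.picture = (f, {T, U, V, W, T ∪ U, V ∪ W}) := by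
  have key : ∀ t u v w : ℕ, t < 256 → u < 256 → v < 256 → w < 256 → (labelsOf t).card = 2 →
      (labelsOf u).card = 2 → (labelsOf v).card = 2 → Disjoint (labelsOf t) (labelsOf u) →
      Disjoint (labelsOf t ∪ labelsOf u) (labelsOf v) →
      labelsOf w = ((labelsOf t ∪ labelsOf u) ∪ labelsOf v)ᶜ → t < u → v < w → t < v →
      ∃ c ∈ pairCodes f, c.picture = (f, {labelsOf t, labelsOf u, labelsOf v, labelsOf w,
        labelsOf t ∪ labelsOf u, labelsOf v ∪ labelsOf w}) := by
    intro t u v w ht hu hv hw hT hU hV hTU hd hW htu hvw htv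
    have hw' : w = 255 ^^^ ((t ||| u) ||| v) := labelsOf_injOn hw
      (Nat.xor_lt_two_pow (n := 8) (by norm_num)
        (Nat.or_lt_two_pow (n := 8) (Nat.or_lt_two_pow (n := 8) ht hu) hv))
      (by rw [labelsOf_compl, labelsOf_or, labelsOf_or, hW])
    subst hw'
    refine ⟨_, List.mem_flatMap.2 ⟨t, mem_masksOfCard ht hT, List.mem_flatMap.2 ⟨u,
      List.mem_filter.2 ⟨mem_masksOfCard hu hU, ?_⟩, List.mem_map.2 ⟨v,
      List.mem_filter.2 ⟨mem_masksOfCard hv hV, ?_⟩, rfl⟩⟩⟩, ?_⟩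
    · rw [and_eq_zero_of_disjoint ht hTU, blt_of_lt htu]; rfl
    · rw [and_eq_zero_of_disjoint (Nat.or_lt_two_pow (n := 8) ht hu) (by rwa [labelsOf_or]),
        blt_of_lt hvw, blt_of_lt htv]; rfl
    · rw [← labelsOf_or, ← labelsOf_or]; simp [Code.picture, setsOf]
  have disj : ∀ {t u v w : Finset (Fin 8)}, Disjoint t u → Disjoint (t ∪ u) v →
      w = ((t ∪ u) ∪ v)ᶜ → Disjoint v w ∧ Disjoint (v ∪ w) t ∧ u = ((v ∪ w) ∪ t)ᶜ ∧
      v = ((t ∪ u) ∪ w)ᶜ ∧ Disjoint (t ∪ u) w := by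
    rintro t u v w h1 h2 rfl
    rw [Finset.disjoint_left] at h1 h2
    refine ⟨?_, ?_, ?_, ?_, ?_⟩
    · rw [Finset.disjoint_left]; intro i hi; simp [hi]
    · rw [Finset.disjoint_left]; intro i hi hi'
      have := h2 (a := i); simp [hi'] at this hi; tauto
    · ext i; have := h1 (a := i); have := h2 (a := i)
      simp only [Finset.mem_compl, Finset.mem_union] at *; tauto
    · ext i; have := h2 (a := i)
      simp only [Finset.mem_compl, Finset.mem_union] at *; tauto
    · rw [Finset.disjoint_left]; intro i hi; simp only [Finset.mem_compl, Finset.mem_union] at *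
      tauto
  obtain ⟨t, ht, rfl⟩ := exists_labelsOf T
  obtain ⟨u, hu, rfl⟩ := exists_labelsOf U
  obtain ⟨v, hv, rfl⟩ := exists_labelsOf V
  obtain ⟨w, hw, rfl⟩ := exists_labelsOf W
  have key' : ∀ t u v w : ℕ, t < 256 → u < 256 → v < 256 → w < 256 → (labelsOf t).card = 2 →
      (labelsOf u).card = 2 → (labelsOf v).card = 2 → (labelsOf w).card = 2 →
      Disjoint (labelsOf t) (labelsOf u) →
      Disjoint (labelsOf t ∪ labelsOf u) (labelsOf v) →
      labelsOf w = ((labelsOf t ∪ labelsOf u) ∪ labelsOf v)ᶜ → t < u → v < w →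
      ∃ c ∈ pairCodes f, c.picture = (f, {labelsOf t, labelsOf u, labelsOf v, labelsOf w,
        labelsOf t ∪ labelsOf u, labelsOf v ∪ labelsOf w}) := by
    intro t u v w ht hu hv hw hT hU hV hW hTU hd hWc htu hvw
    have hne : t ≠ v := labelsOf_ne (Disjoint.mono_left Finset.subset_union_left hd) (by omega)
    rcases lt_or_gt_of_ne hne with h | h
    · exact key t u v w ht hu hv hw hT hU hV hTU hd hWc htu hvw h
    · obtain ⟨h1, h2, h3, -, -⟩ := disj hTU hd hWc
      obtain ⟨c, hc, hp⟩ := key v w t u hv hw ht hu hV hW hT h1 h2 h3 hvw htu h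
      refine ⟨c, hc, hp.trans (Prod.ext rfl ?_)⟩
      ext X
      simp only [Finset.mem_insert, Finset.mem_singleton]
      constructor <;> rintro (rfl | rfl | rfl | rfl | rfl | rfl) <;> simp
  have key'' : ∀ t u v w : ℕ, t < 256 → u < 256 → v < 256 → w < 256 → (labelsOf t).card = 2 →
      (labelsOf u).card = 2 → (labelsOf v).card = 2 → (labelsOf w).card = 2 →
      Disjoint (labelsOf t) (labelsOf u) →
      Disjoint (labelsOf t ∪ labelsOf u) (labelsOf v) →
      labelsOf w = ((labelsOf t ∪ labelsOf u) ∪ labelsOf v)ᶜ → t < u →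
      ∃ c ∈ pairCodes f, c.picture = (f, {labelsOf t, labelsOf u, labelsOf v, labelsOf w,
        labelsOf t ∪ labelsOf u, labelsOf v ∪ labelsOf w}) := by
    intro t u v w ht hu hv hw hT hU hV hW hTU hd hWc htu
    obtain ⟨h1, h2, h3, h4, h5⟩ := disj hTU hd hWc
    rcases lt_or_gt_of_ne (labelsOf_ne h1 (by omega)) with h | h
    · exact key' t u v w ht hu hv hw hT hU hV hW hTU hd hWc htu h
    · obtain ⟨c, hc, hp⟩ := key' t u w v ht hu hw hv hT hU hW hV hTU h5 h4 htu h
      refine ⟨c, hc, hp.trans (Prod.ext rfl ?_)⟩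
      rw [Finset.union_comm (labelsOf w)]
      ext X
      simp only [Finset.mem_insert, Finset.mem_singleton]
      constructor <;> rintro (rfl | rfl | rfl | rfl | rfl | rfl) <;> simp
  rcases lt_or_gt_of_ne (labelsOf_ne hTU (by omega)) with h | h
  · exact key'' t u v w ht hu hv hw hT hU hV hW hTU hd hWc h
  · obtain ⟨c, hc, hp⟩ := key'' u t v w hu ht hv hw hU hT hV hW hTU.symm
      (by rwa [Finset.union_comm]) (by rw [hWc, Finset.union_comm (labelsOf t)]) h
    refine ⟨c, hc, hp.trans (Prod.ext rfl ?_)⟩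
    rw [Finset.union_comm (labelsOf u)]
    ext X
    simp only [Finset.mem_insert, Finset.mem_singleton]
    constructor <;> rintro (rfl | rfl | rfl | rfl | rfl | rfl) <;> simp

theorem map_compl_perm (σ : Equiv.Perm (Fin 8)) (T : Finset (Fin 8)) :
    Tᶜ.map σ.toEmbedding = (T.map σ.toEmbedding)ᶜ := by
  ext i
  simp [Finset.mem_map_equiv]

/-- Every picture of a building block has a code. -/
theorem exists_code (f : Family) (σ : Equiv.Perm (Fin 8)) :
    ∃ c ∈ codes, c.picture = f.stdPicture.relabel σ := by
  have quad : ∀ f : Family, ∃ c ∈ quadCodes f, c.picture =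
      (f, Finset.image (fun T : Finset (Fin 8) => T.map σ.toEmbedding)
        {{0, 1, 2, 3}, {0, 1, 2, 3}ᶜ}) := by
    intro f
    obtain ⟨c, hc, hp⟩ := exists_quadCodes f
      (T := ({0, 1, 2, 3} : Finset (Fin 8)).map σ.toEmbedding) (by rw [Finset.card_map]; rfl)
    refine ⟨c, hc, hp.trans ?_⟩
    rw [Finset.image_insert, Finset.image_singleton, map_compl_perm]
  cases f with
  | alpha1 =>
    obtain ⟨c, hc, hp⟩ := exists_singleCodes .alpha1
      (T := ({0, 1} : Finset (Fin 8)).map σ.toEmbedding) (k := 2) (by rw [Finset.card_map]; rfl)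
    refine ⟨c, by simp [codes, hc], hp.trans ?_⟩
    simp only [Picture.relabel, Family.stdPicture, picAlpha1, Finset.image_singleton]
  | chi2 =>
    obtain ⟨c, hc, hp⟩ := exists_singleCodes .chi2
      (T := ({0, 1, 2} : Finset (Fin 8)).map σ.toEmbedding) (k := 3) (by rw [Finset.card_map]; rfl)
    refine ⟨c, by simp [codes, hc], hp.trans ?_⟩
    simp only [Picture.relabel, Family.stdPicture, picChi2, Finset.image_singleton]
  | alpha2 => obtain ⟨c, hc, hp⟩ := quad .alpha2; exact ⟨c, by simp [codes, hc], hp⟩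
  | phi3 => obtain ⟨c, hc, hp⟩ := quad .phi3; exact ⟨c, by simp [codes, hc], hp⟩
  | line => obtain ⟨c, hc, hp⟩ := quad .line; exact ⟨c, by simp [codes, hc], hp⟩
  | tcu => exact ⟨(.tcu, []), by simp [codes], rfl⟩
  | chi1 =>
    obtain ⟨c, hc, hp⟩ := exists_tripleCodes .chi1
      (T := ({0, 1} : Finset (Fin 8)).map σ.toEmbedding)
      (U := ({2, 3, 4} : Finset (Fin 8)).map σ.toEmbedding) (by rw [Finset.card_map]; rfl)
      (by rw [Finset.card_map]; rfl) (by rw [Finset.disjoint_map]; decide)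
    refine ⟨c, by simp [codes, hc], hp.trans ?_⟩
    rw [← Finset.map_union, ← map_compl_perm]
    simp only [Picture.relabel, Family.stdPicture, picChi1, Finset.image_insert,
      Finset.image_singleton]
    rfl
  | phi2 =>
    obtain ⟨c, hc, hp⟩ := exists_tripleCodes .phi2
      (T := ({3, 4} : Finset (Fin 8)).map σ.toEmbedding)
      (U := ({0, 1, 2} : Finset (Fin 8)).map σ.toEmbedding) (by rw [Finset.card_map]; rfl)
      (by rw [Finset.card_map]; rfl) (by rw [Finset.disjoint_map]; decide)
    refine ⟨c, by simp [codes, hc], hp.trans ?_⟩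
    rw [← Finset.map_union, ← map_compl_perm]
    simp only [Picture.relabel, Family.stdPicture, picPhi2]
    rw [show (({3, 4} : Finset (Fin 8)) ∪ {0, 1, 2})ᶜ = {5, 6, 7} by decide,
      show (({0, 1, 2} : Finset (Fin 8)) ∪ {5, 6, 7})ᶜ = {3, 4} by decide]
    simp only [Finset.image_insert, Finset.image_singleton]
    refine Prod.ext rfl ?_
    ext X
    simp only [Finset.mem_insert, Finset.mem_singleton]
    constructor <;> rintro (rfl | rfl | rfl | rfl | rfl | rfl) <;> simp
  | phi1 =>
    obtain ⟨c, hc, hp⟩ := exists_pairCodes .phi1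
      (T := ({0, 1} : Finset (Fin 8)).map σ.toEmbedding)
      (U := ({2, 3} : Finset (Fin 8)).map σ.toEmbedding)
      (V := ({4, 5} : Finset (Fin 8)).map σ.toEmbedding)
      (W := ({6, 7} : Finset (Fin 8)).map σ.toEmbedding)
      (by rw [Finset.card_map]; rfl) (by rw [Finset.card_map]; rfl) (by rw [Finset.card_map]; rfl)
      (by rw [Finset.card_map]; rfl) (by rw [Finset.disjoint_map]; decide)
      (by rw [← Finset.map_union, Finset.disjoint_map]; decide)
      (by rw [← Finset.map_union, ← Finset.map_union, ← map_compl_perm]; congr 1)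
    refine ⟨c, by simp [codes, hc], hp.trans ?_⟩
    simp only [Picture.relabel, Family.stdPicture, picPhi1, Finset.image_insert,
      Finset.image_singleton, Finset.map_union]

theorem Block.exists_code (B : Block) : ∃ c ∈ codes, c.picture = B.picture :=
  CayleyOctad.exists_code _ _

/-! ### Entries of the building blocks modulo lineality -/

/-- The bit masks of the standard picture of a family. -/
def stdMasks : Family → List ℕ
  | .alpha1 => [3]
  | .alpha2 => [15, 240]
  | .chi1 => [3, 28, 224]
  | .chi2 => [7]
  | .phi1 => [3, 12, 48, 192, 15, 240]
  | .phi2 => [7, 224, 24]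
  | .phi3 => [15, 240]
  | .tcu => []
  | .line => [15, 240]

theorem setsOf_stdMasks (f : Family) : (f, setsOf (stdMasks f)) = f.stdPicture := by
  cases f <;> decide +kernel

theorem isMaskList_stdMasks (f : Family) : IsMaskList (stdMasks f) := by
  have : (stdMasks f).Nodup ∧ ∀ m ∈ stdMasks f, m < 256 := by cases f <;> decide
  exact this

/-- The entries of a standard block at a set `S`, where `n m` is the number of elements that `S`
has in common with the set with bit mask `m`. -/
def stdEntry : Kind → (ℕ → ℕ) → ℕ
  | .alpha1a, n => n 3 - 1
  | .alpha1b, n => n 252 - 3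
  | .alpha2a, n => (n 15 - 3) + (n 240 - 3)
  | .alpha2b, n => (n 15 - 3) + (n 15 - 1)
  | .chi1a, n => max ((n 28 - 2) + (n 224 - 2)) (n 252 - 3)
  | .chi1b, n => max (n 3 - 1) ((n 31 - 3) + (n 227 - 3))
  | .chi1c, n => max ((n 31 - 2) + (n 28 - 2)) (n 28 - 1)
  | .chi2a, n => (n 248 - 2) + (n 248 - 3)
  | .chi2b, n => (n 7 - 2) + (n 7 - 1)
  | .chi2c, n => (n 7 - 2) + (n 248 - 3)
  | .phi1a, n => (n 51 - 2) + (n 195 - 2) + (n 15 - 3) + (n 240 - 3)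
  | .phi1b, n => max ((n 3 - 1) + (n 12 - 1)) ((n 63 - 3) + (n 207 - 3))
  | .phi2a, n => max ((n 7 - 2) + (n 224 - 2)) ((n 31 - 3) + (n 248 - 3))
  | .phi2b, n => (n 24 - 1) + (n 15 - 2) + (n 23 - 2)
  | .phi2c, n => (n 15 - 2) + (n 23 - 2) + (n 231 - 3)
  | .phi3a, n => (n 15 - 2) + (n 15 - 3) + (n 240 - 3)
  | .phi3b, n => (n 15 - 1) + (n 15 - 2) + (n 15 - 3)
  | .tcu, _ => 0
  | .line, n => n 15 - 2

/-- Four times the element of the lineality space by which a standard block differs from the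
symmetric representative. -/
def stdShift : Kind → List ℤ
  | .alpha1b => [-3, -3, 1, 1, 1, 1, 1, 1]
  | .alpha2b => [3, 3, 3, 3, -1, -1, -1, -1]
  | .chi1b => [3, 3, -1, -1, -1, -1, -1, -1]
  | .chi1c => [2, 2, 2, 2, 2, -2, -2, -2]
  | .chi2b => [5, 5, 5, -3, -3, -3, -3, -3]
  | .chi2c => [2, 2, 2, -2, -2, -2, -2, -2]
  | .phi1a => [2, 2, -2, -2, 0, 0, 0, 0]
  | .phi1b => [1, 1, 1, 1, -1, -1, -1, -1]
  | .phi2a => [0, 0, 0, -2, -2, 0, 0, 0]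
  | .phi2b => [2, 2, 2, 0, 0, -2, -2, -2]
  | .phi2c => [3, 3, 3, -3, -3, -1, -1, -1]
  | .phi3a => [1, 1, 1, 1, -1, -1, -1, -1]
  | .phi3b => [4, 4, 4, 4, -2, -2, -2, -2]
  | .line => [1, 1, 1, 1, -1, -1, -1, -1]
  -- The remaining kinds are the symmetric representatives themselves; `getD` reads the empty list
  -- as the zero shift.
  | _ => []

theorem max_zero_natCast_sub (n k : ℕ) : max 0 ((n : ℚ) - k) = ((n - k : ℕ) : ℚ) := by
  rcases le_total k n with h | h
  · rw [Nat.cast_sub h, max_eq_right]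
    exact sub_nonneg.2 (Nat.cast_le.2 h)
  · rw [Nat.sub_eq_zero_of_le h, Nat.cast_zero, max_eq_left]
    exact sub_nonpos.2 (Nat.cast_le.2 h)

theorem vpt_apply (m : ℕ) (S : Quad) :
    (vpt (labelsOf m)).1 S = (((S.1 ∩ labelsOf m).card - 1 : ℕ) : ℚ) := by
  have h := max_zero_natCast_sub (S.1 ∩ labelsOf m).card 1
  rwa [Nat.cast_one] at h

theorem vln_apply (m : ℕ) (S : Quad) :
    (vln (labelsOf m)).1 S = (((S.1 ∩ labelsOf m).card - 2 : ℕ) : ℚ) := by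
  have h := max_zero_natCast_sub (S.1 ∩ labelsOf m).card 2
  rwa [Nat.cast_ofNat] at h

theorem vpln_apply (m : ℕ) (S : Quad) :
    (vpln (labelsOf m)).1 S = (((S.1 ∩ labelsOf m).card - 3 : ℕ) : ℚ) := by
  have h := max_zero_natCast_sub (S.1 ∩ labelsOf m).card 3
  rwa [Nat.cast_ofNat] at h

/-- Truncated subtraction of naturals computes the positive parts in the coincidence vectors, so the
standard blocks become functions that can be evaluated on bit masks. -/
theorem std_apply (k : Kind) (S : Quad) :
    k.std.1 S = (stdEntry k fun m => (S.1 ∩ labelsOf m).card : ℕ) := by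
  have h3 : ({0, 1} : Finset (Fin 8)) = labelsOf 3 := by decide
  have h252 : ({2, 3, 4, 5, 6, 7} : Finset (Fin 8)) = labelsOf 252 := by decide
  have h15 : ({0, 1, 2, 3} : Finset (Fin 8)) = labelsOf 15 := by decide
  have h240 : ({4, 5, 6, 7} : Finset (Fin 8)) = labelsOf 240 := by decide
  have h28 : ({2, 3, 4} : Finset (Fin 8)) = labelsOf 28 := by decide
  have h224 : ({5, 6, 7} : Finset (Fin 8)) = labelsOf 224 := by decide
  have h31 : ({0, 1, 2, 3, 4} : Finset (Fin 8)) = labelsOf 31 := by decide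
  have h227 : ({0, 1, 5, 6, 7} : Finset (Fin 8)) = labelsOf 227 := by decide
  have h248 : ({3, 4, 5, 6, 7} : Finset (Fin 8)) = labelsOf 248 := by decide
  have h7 : ({0, 1, 2} : Finset (Fin 8)) = labelsOf 7 := by decide
  have h51 : ({0, 1, 4, 5} : Finset (Fin 8)) = labelsOf 51 := by decide
  have h195 : ({0, 1, 6, 7} : Finset (Fin 8)) = labelsOf 195 := by decide
  have h12 : ({2, 3} : Finset (Fin 8)) = labelsOf 12 := by decide
  have h63 : ({0, 1, 2, 3, 4, 5} : Finset (Fin 8)) = labelsOf 63 := by decide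
  have h207 : ({0, 1, 2, 3, 6, 7} : Finset (Fin 8)) = labelsOf 207 := by decide
  have h24 : ({3, 4} : Finset (Fin 8)) = labelsOf 24 := by decide
  have h23 : ({0, 1, 2, 4} : Finset (Fin 8)) = labelsOf 23 := by decide
  have h231 : ({0, 1, 2, 5, 6, 7} : Finset (Fin 8)) = labelsOf 231 := by decide
  cases k <;>
    simp only [Kind.std, stdEntry, ↓h3, ↓h252, ↓h15, ↓h240, ↓h28, ↓h224, ↓h31, ↓h227, ↓h248,
      ↓h7, ↓h51, ↓h195, ↓h12, ↓h63, ↓h207, ↓h24, ↓h23, ↓h231, Prod.fst_add, Pi.add_apply,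
      Prod.fst_sup, Pi.sup_apply, vpt_apply, vln_apply, vpln_apply, Nat.cast_add, Nat.cast_max, vtc, Pi.zero_apply,
      Nat.cast_zero]

/-- A check at the 70 quadruples. The factor 4 clears the halves in the symmetric entries and the
quarters in the shifts. -/
theorem stdEntry_eq (k : Kind) : ∀ s ∈ masksOfCard 4,
    4 * (stdEntry k fun m => bitCount (s &&& m) : ℕ) =
      2 * (entryOfPairing k.family (maskPairing (stdMasks k.family) [s]) : ℤ) +
        ∑ i ∈ labelsOf s, (stdShift k).getD i 0 := by
  cases k <;> decide +kernel

theorem setsOf_singleton (s : ℕ) : setsOf [s] = {labelsOf s} := by simp [setsOf]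

theorem isMaskList_singleton {s : ℕ} (hs : s < 256) : IsMaskList [s] :=
  ⟨List.nodup_singleton s, by simpa using hs⟩

theorem std_eq_entry (k : Kind) (S : Quad) :
    2 * k.std.1 S = entry k.family.stdPicture S.1 +
      ∑ i ∈ S.1, (((stdShift k).getD i 0 : ℤ) : ℚ) / 2 := by
  obtain ⟨S, hS⟩ := S
  obtain ⟨s, hs, rfl⟩ := exists_labelsOf S
  have h := stdEntry_eq k s (mem_masksOfCard hs hS)
  have h1 : entry k.family.stdPicture (labelsOf s) =
      entryOfPairing k.family (maskPairing (stdMasks k.family) [s]) := by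
    rw [← setsOf_stdMasks, entry, ← setsOf_singleton,
      pairing_setsOf (isMaskList_stdMasks _) (isMaskList_singleton hs)]
  have h2 : (fun m => (labelsOf s ∩ labelsOf m).card) = fun m => bitCount (s &&& m) := by
    funext m
    rw [← labelsOf_and, card_labelsOf (lt_of_le_of_lt Nat.and_le_left hs)]
  rw [std_apply, h1, h2, ← Finset.sum_div]
  have h' : (4 : ℚ) * (stdEntry k fun m => bitCount (s &&& m) : ℕ) =
      2 * (entryOfPairing k.family (maskPairing (stdMasks k.family) [s]) : ℚ) +
        ∑ i ∈ labelsOf s, (((stdShift k).getD i 0 : ℤ) : ℚ) := by exact_mod_cast h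
  linarith

/-- Modulo lineality a building block only depends on its picture. -/
theorem Block.exists_val_eq (B : Block) : ∃ a : Fin 8 → ℚ, ∀ S : Quad,
    2 * B.val.1 S = entry B.picture S.1 + ∑ i ∈ S.1, a i := by
  refine ⟨fun i => (((stdShift B.kind).getD (B.label.symm i) 0 : ℤ) : ℚ) / 2, fun S => ?_⟩
  have h := std_eq_entry B.kind ⟨S.1.map B.label.symm.toEmbedding, by rw [Finset.card_map, S.2]⟩
  have hS : (S.1.map B.label.symm.toEmbedding).map B.label.toEmbedding = S.1 := by
    rw [Finset.map_map]
    convert Finset.map_refl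
    ext i
    simp
  rw [← entry_relabel B.label, hS, Finset.sum_map] at h
  exact h

theorem Block.val_snd (B : Block) : B.val.2 = if B.kind.family = .tcu then 1 else 0 := by
  obtain ⟨k, σ⟩ := B
  cases k <;>
    simp [Block.val, relabel, Kind.std, Kind.family, vpt, vln, vpln, vtc]

/-! ### Adjacency of pictures -/

/-- The values of the pairing for compatible pictures of two families (in one order). -/
def compatPairings : Family → Family → List ℕ
  | .alpha1, .alpha1 => [0, 16]
  | .alpha1, .alpha2 => [32]
  | .alpha1, .chi1 => [16, 24]
  | .alpha1, .chi2 => [0, 24]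
  | .alpha1, .phi1 => [48]
  | .alpha1, .phi2 => [24]
  | .alpha1, .phi3 => [32]
  | .alpha1, .tcu => [0]
  | .alpha1, .line => [32]
  | .alpha2, .alpha2 => [256, 512]
  | .alpha2, .chi1 => [152, 232]
  | .alpha2, .chi2 => [108]
  | .alpha2, .phi1 => [352]
  | .alpha2, .phi2 => [200]
  | .alpha2, .line => [320]
  | .chi1, .chi1 => [102, 178]
  | .chi1, .chi2 => [81]
  | .chi1, .phi1 => [228]
  | .chi1, .phi2 => [138]
  | .chi1, .line => [200]
  | .chi2, .chi2 => [0, 81]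
  | .chi2, .phi2 => [81]
  | .chi2, .phi3 => [108]
  | .chi2, .tcu => [0]
  | .chi2, .line => [108]
  | .phi1, .phi1 => [832]
  | .phi2, .phi2 => [178]
  | .phi3, .phi3 => [512]
  | .tcu, .tcu => [0]
  | .line, .line => [512]
  | _, _ => []

/-- The values of the pairing of a picture of a `φ`-block with its auxiliary pictures. -/
def auxPairings : Family → Family → List ℕ
  | .phi1, .alpha2 => [640]
  | .phi1, .line => [384]
  | .phi2, .alpha1 => [16]
  | .phi2, .line => [232]
  | .phi3, .alpha2 => [512]
  | .phi3, .tcu => [0]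
  | .phi3, .line => [512]
  | _, _ => []

/-- The values of the pairing for compatible pictures of two families. -/
def symmCompatPairings (f g : Family) : List ℕ := compatPairings f g ++ compatPairings g f

/-- The values of the pairing for adjacent pictures of two families: pictures that are compatible
or one of which is auxiliary to the other. -/
def adjPairings (f g : Family) : List ℕ :=
  f.table
    (g.table [0, 16] [32] [16, 24] [0, 24] [48] [16, 24] [32] [0] [32])
    (g.table [32] [256, 512] [152, 232] [108] [352, 640] [200] [512] [] [320])
    (g.table [16, 24] [152, 232] [102, 178] [81] [228] [138] [] [] [200])
    (g.table [0, 24] [108] [81] [0, 81] [] [81] [108] [0] [108])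
    (g.table [48] [352, 640] [228] [] [832] [] [] [] [384])
    (g.table [16, 24] [200] [138] [81] [] [178] [] [] [232])
    (g.table [32] [512] [] [108] [] [] [512] [0] [512])
    (g.table [0] [] [] [0] [] [] [0] [0] [])
    (g.table [32] [320] [200] [108] [384] [232] [512] [] [512])

theorem adjPairings_comm (f g : Family) : adjPairings f g = adjPairings g f := by
  cases f <;> cases g <;> rfl

theorem mem_adjPairings_of_compat (f g : Family) :
    ∀ k ∈ symmCompatPairings f g, k ∈ adjPairings f g := by
  cases f <;> cases g <;> decide

/-- Two pictures are adjacent if they are compatible or one is auxiliary to the other, as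
recognised by their pairing. -/
def Adj (P Q : Picture) : Prop := pairing P.2 Q.2 ∈ adjPairings P.1 Q.1

theorem Adj.symm {P Q : Picture} (h : Adj P Q) : Adj Q P := by
  unfold Adj at *
  rwa [pairing_comm, adjPairings_comm]

theorem Adj.relabel {P Q : Picture} (h : Adj P Q) (σ : Equiv.Perm (Fin 8)) :
    Adj (P.relabel σ) (Q.relabel σ) := by
  unfold Adj at *
  rw [pairing_relabel]
  exact h

/-- The pairing is invariant under relabelling, so only the standard pictures and the entries of the
table need to be checked. -/
theorem mem_symmCompatPairings_of_compatible {B B' : Block}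
    (h : CompatiblePictures B.picture B'.picture) :
    pairing B.picture.2 B'.picture.2 ∈ symmCompatPairings B.picture.1 B'.picture.1 := by
  rcases h with h | ⟨σ, e, he, h⟩
  · rw [← h, Block.picture, pairing_relabel]
    have : ∀ f : Family, pairing f.stdPicture.2 f.stdPicture.2 ∈
        symmCompatPairings f.stdPicture.1 f.stdPicture.1 := by
      intro f; cases f <;> decide +kernel
    exact this _
  · have key : ∀ e ∈ compatTable, pairing e.1.2 e.2.2 ∈ symmCompatPairings e.1.1 e.2.1 ∧
        pairing e.2.2 e.1.2 ∈ symmCompatPairings e.2.1 e.1.1 := by decide +kernel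
    rcases h with ⟨h1, h2⟩ | ⟨h1, h2⟩ <;> rw [h1, h2, pairing_relabel]
    · exact (key e he).1
    · exact (key e he).2

theorem mem_auxPairings_of_isAuxiliaryTo {P Q : Picture} (h : IsAuxiliaryTo Q P) :
    pairing P.2 Q.2 ∈ auxPairings P.1 Q.1 := by
  obtain ⟨σ, e, he, h1, h2⟩ := h
  have key : ∀ e ∈ auxTable, pairing e.1.2 e.2.2 ∈ auxPairings e.1.1 e.2.1 := by decide +kernel
  rw [h1, h2, pairing_relabel]
  exact key e he

theorem adj_of_compatible {B B' : Block} (h : CompatiblePictures B.picture B'.picture) :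
    Adj B.picture B'.picture :=
  mem_adjPairings_of_compat _ _ _ (mem_symmCompatPairings_of_compatible h)

/-- A picture is not compatible with an auxiliary picture. -/
theorem not_compatible_of_isAuxiliaryTo {B B' : Block}
    (h : IsAuxiliaryTo B'.picture B.picture) : ¬ CompatiblePictures B'.picture B.picture := by
  intro hc
  have h1 := mem_auxPairings_of_isAuxiliaryTo h
  have h2 := mem_symmCompatPairings_of_compatible hc
  -- For each pair of families, the pairing values of auxiliary pictures and of compatible pictures
  -- are disjoint.
  have key : ∀ f g : Family, ∀ k ∈ auxPairings f g, k ∉ symmCompatPairings g f := by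
    intro f g; cases f <;> cases g <;> decide
  rw [pairing_comm] at h2
  exact key _ _ _ h1 h2

/-! ### Functions of pictures that are determined by the valuation data -/

/-- Nonnegative combinations of pairwise adjacent building blocks. -/
structure IsAdmissible (t : Block →₀ ℚ) : Prop where
  nonneg : ∀ B, 0 ≤ t B
  adj : ∀ B ∈ t.support, ∀ B' ∈ t.support, Adj B.picture B'.picture

/-- The weighted sum of a function of pictures over a combination of building blocks. -/
def total (t : Block →₀ ℚ) (f : Picture → ℤ) : ℚ :=
  t.sum fun B c => c * (f B.picture : ℚ)

/-- The valuation data of a combination of building blocks. -/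
def combine (t : Block →₀ ℚ) : ValData := t.sum fun B c => c • B.val

/-- The total of `f` is determined by the valuation data of an admissible combination. -/
def Determined (f : Picture → ℤ) : Prop :=
  ∀ t t' : Block →₀ ℚ, IsAdmissible t → IsAdmissible t' → combine t = combine t' →
    total t f = total t' f

theorem total_congr {t : Block →₀ ℚ} {f g : Picture → ℤ}
    (h : ∀ B ∈ t.support, f B.picture = g B.picture) : total t f = total t g :=
  Finset.sum_congr rfl fun B hB => by simp only [h B hB]

theorem total_add (t : Block →₀ ℚ) (f g : Picture → ℤ) :
    total t (fun P => f P + g P) = total t f + total t g := by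
  simp only [total, Finsupp.sum, ← Finset.sum_add_distrib, Int.cast_add, mul_add]

theorem total_mul (t : Block →₀ ℚ) (k : ℤ) (f : Picture → ℤ) :
    total t (fun P => k * f P) = k * total t f := by
  simp only [total, Finsupp.sum, Finset.mul_sum, Int.cast_mul]
  exact Finset.sum_congr rfl fun B _ => by ring

theorem total_mono {t : Block →₀ ℚ} (ht : ∀ B, 0 ≤ t B) {f g : Picture → ℤ}
    (h : ∀ B ∈ t.support, f B.picture ≤ g B.picture) : total t f ≤ total t g :=
  Finset.sum_le_sum fun B hB => mul_le_mul_of_nonneg_left (Int.cast_le.2 (h B hB)) (ht B)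

theorem Determined.congr {f g : Picture → ℤ} (hf : Determined f)
    (h : ∀ B : Block, f B.picture = g B.picture) : Determined g := by
  intro t t' ht ht' htt
  rw [← total_congr fun B _ => h B, ← total_congr fun B _ => h B]
  exact hf t t' ht ht' htt

theorem Determined.add {f g : Picture → ℤ} (hf : Determined f) (hg : Determined g) :
    Determined fun P => f P + g P := by
  intro t t' ht ht' htt
  rw [total_add, total_add, hf t t' ht ht' htt, hg t t' ht ht' htt]

theorem Determined.mul {f : Picture → ℤ} (hf : Determined f) (k : ℤ) :
    Determined fun P => k * f P := by
  intro t t' ht ht' htt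
  rw [total_mul, total_mul, hf t t' ht ht' htt]

theorem Determined.of_mul {f : Picture → ℤ} {k : ℤ} (hk : k ≠ 0)
    (hf : Determined fun P => k * f P) : Determined f := by
  intro t t' ht ht' htt
  have := hf t t' ht ht' htt
  rw [total_mul, total_mul] at this
  exact mul_left_cancel₀ (Int.cast_ne_zero.2 hk) this

theorem Determined.sub {f g : Picture → ℤ} (hf : Determined f) (hg : Determined g) :
    Determined fun P => f P - g P :=
  (hf.add (hg.mul (-1))).congr fun B => by ring

theorem determined_zero : Determined fun _ => 0 := by
  intro t t' _ _ _
  simp [total]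

/-- Two functions of pictures are comparable in the same direction on adjacent pictures. -/
def Coherent (f g : Picture → ℤ) : Prop :=
  ∀ B B' : Block, Adj B.picture B'.picture → f B.picture < g B.picture →
    ¬ g B'.picture < f B'.picture

/-- Pairwise adjacency of the support leaves no room for two blocks on which `f` and `g` compare
strictly in opposite directions. One of them is therefore the minimum on the whole support, and the
sum of minima is the minimum of sums. -/
theorem total_min {t : Block →₀ ℚ} (ht : IsAdmissible t) {f g : Picture → ℤ}
    (h : Coherent f g) : total t (fun P => min (f P) (g P)) = min (total t f) (total t g) := by
  by_cases hle : ∀ B ∈ t.support, f B.picture ≤ g B.picture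
  · rw [min_eq_left (total_mono ht.nonneg hle)]
    exact total_congr fun B hB => min_eq_left (hle B hB)
  · push Not at hle
    obtain ⟨B₀, hB₀, hlt⟩ := hle
    have hge : ∀ B ∈ t.support, g B.picture ≤ f B.picture := fun B hB => by
      by_contra hlt'
      exact h B B₀ (ht.adj B hB B₀ hB₀) (not_le.1 hlt') hlt
    rw [min_eq_right (total_mono ht.nonneg hge)]
    exact total_congr fun B hB => min_eq_right (hge B hB)

theorem Determined.min {f g : Picture → ℤ} (hf : Determined f) (hg : Determined g)
    (h : Coherent f g) : Determined fun P => Min.min (f P) (g P) := by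
  intro t t' ht ht' htt
  rw [total_min ht h, total_min ht' h, hf t t' ht ht' htt, hg t t' ht ht' htt]

/-! ### Invariance of determined functions under relabelling -/

/-- Relabelling of building blocks. -/
def Block.relabelEquiv (σ : Equiv.Perm (Fin 8)) : Block ≃ Block where
  toFun B := ⟨B.kind, σ * B.label⟩
  invFun B := ⟨B.kind, σ⁻¹ * B.label⟩
  left_inv B := by simp
  right_inv B := by simp

theorem Block.picture_relabelEquiv (σ : Equiv.Perm (Fin 8)) (B : Block) :
    (Block.relabelEquiv σ B).picture = B.picture.relabel σ :=
  (Picture.relabel_relabel _ _ _).symm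

theorem relabel_mul (σ τ : Equiv.Perm (Fin 8)) (v : ValData) :
    relabel (σ * τ) v = relabel σ (relabel τ v) := by
  refine Prod.ext ?_ rfl
  funext S
  simp only [relabel, Finset.map_map]
  congr 1

theorem relabel_combine (σ : Equiv.Perm (Fin 8)) (t : Block →₀ ℚ) :
    combine (t.equivMapDomain (Block.relabelEquiv σ)) = relabel σ (combine t) := by
  have hadd : ∀ s : Finset Block, relabel σ (∑ B ∈ s, t B • B.val) =
      ∑ B ∈ s, t B • relabel σ B.val := by
    intro s
    induction s using Finset.induction_on with
    | empty => rfl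
    | insert B s hB ih => rw [Finset.sum_insert hB, Finset.sum_insert hB, ← ih]; rfl
  rw [combine, combine, Finsupp.sum_equivMapDomain, Finsupp.sum, Finsupp.sum, hadd]
  refine Finset.sum_congr rfl fun B _ => ?_
  congr 1
  exact relabel_mul _ _ _

theorem IsAdmissible.relabel {t : Block →₀ ℚ} (ht : IsAdmissible t) (σ : Equiv.Perm (Fin 8)) :
    IsAdmissible (t.equivMapDomain (Block.relabelEquiv σ)) := by
  constructor
  · intro B
    rw [Finsupp.equivMapDomain_apply]
    exact ht.nonneg _
  · intro B hB B' hB'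
    obtain ⟨C, rfl⟩ := (Block.relabelEquiv σ).surjective B
    obtain ⟨C', rfl⟩ := (Block.relabelEquiv σ).surjective B'
    rw [Finsupp.mem_support_iff, Finsupp.equivMapDomain_apply, Equiv.symm_apply_apply,
      ← Finsupp.mem_support_iff] at hB hB'
    have := (ht.adj C hB C' hB').relabel σ
    rw [← Block.picture_relabelEquiv, ← Block.picture_relabelEquiv] at this
    exact this

theorem total_relabel (t : Block →₀ ℚ) (σ : Equiv.Perm (Fin 8)) (f : Picture → ℤ) :
    total (t.equivMapDomain (Block.relabelEquiv σ)) f = total t fun P => f (P.relabel σ) := by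
  rw [total, total, Finsupp.sum_equivMapDomain]
  simp only [Block.picture_relabelEquiv]

theorem Determined.relabel {f : Picture → ℤ} (hf : Determined f) (σ : Equiv.Perm (Fin 8)) :
    Determined fun P => f (P.relabel σ) := by
  intro t t' ht ht' htt
  rw [← total_relabel, ← total_relabel]
  refine hf _ _ (ht.relabel σ) (ht'.relabel σ) ?_
  rw [relabel_combine, relabel_combine, htt]

/-! ### Combinations of entries that do not see the lineality space -/

theorem combine_fst_apply (t : Block →₀ ℚ) (S : Quad) :
    (combine t).1 S = t.sum fun B c => c * B.val.1 S := by
  simp only [combine, Finsupp.sum, Prod.fst_sum, Finset.sum_apply, Prod.smul_fst, Pi.smul_apply,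
    smul_eq_mul]

theorem combine_snd (t : Block →₀ ℚ) : (combine t).2 = t.sum fun B c => c * B.val.2 := by
  simp only [combine, Finsupp.sum, Prod.snd_sum, Prod.smul_snd, smul_eq_mul]

theorem total_entry (t : Block →₀ ℚ) : ∃ a : Fin 8 → ℚ, ∀ S : Quad,
    total t (fun P => entry P S.1) = 2 * (combine t).1 S - ∑ i ∈ S.1, a i := by
  choose a ha using Block.exists_val_eq
  refine ⟨fun i => t.sum fun B c => c * a B i, fun S => ?_⟩
  rw [combine_fst_apply]
  simp only [total, Finsupp.sum, Int.cast_natCast]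
  rw [Finset.sum_comm, Finset.mul_sum, ← Finset.sum_sub_distrib]
  refine Finset.sum_congr rfl fun B _ => ?_
  rw [← Finset.mul_sum]
  have := ha B S
  linear_combination (-t B) * this

/-- The hypothesis says that the unknown lineality shift of `total_entry`, which depends on the
decomposition, cancels in the difference. -/
theorem determined_entry (S₁ S₂ S₃ S₄ : Quad)
    (h : ∀ a : Fin 8 → ℚ, ∑ i ∈ S₁.1, a i + ∑ i ∈ S₂.1, a i = ∑ i ∈ S₃.1, a i + ∑ i ∈ S₄.1, a i) :
    Determined fun P => ((entry P S₁.1 + entry P S₂.1 : ℕ) : ℤ) -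
      (entry P S₃.1 + entry P S₄.1 : ℕ) := by
  intro t t' _ _ htt
  have key : ∀ t : Block →₀ ℚ, total t (fun P => ((entry P S₁.1 + entry P S₂.1 : ℕ) : ℤ) -
      (entry P S₃.1 + entry P S₄.1 : ℕ)) = 2 * ((combine t).1 S₁ + (combine t).1 S₂ -
        (combine t).1 S₃ - (combine t).1 S₄) := by
    intro t
    obtain ⟨a, ha⟩ := total_entry t
    have hsum : total t (fun P => ((entry P S₁.1 + entry P S₂.1 : ℕ) : ℤ) -
        (entry P S₃.1 + entry P S₄.1 : ℕ)) = total t (fun P => entry P S₁.1) +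
        total t (fun P => entry P S₂.1) - total t (fun P => entry P S₃.1) -
        total t (fun P => entry P S₄.1) := by
      simp only [total, Finsupp.sum, ← Finset.sum_add_distrib, ← Finset.sum_sub_distrib]
      refine Finset.sum_congr rfl fun B _ => ?_
      push_cast
      ring
    rw [hsum, ha, ha, ha, ha]
    linear_combination -(h a)
  rw [key, key, htt]

theorem determined_tcu : Determined fun P => if P.1 = .tcu then 1 else 0 := by
  have key : ∀ t : Block →₀ ℚ,
      total t (fun P => if P.1 = .tcu then 1 else 0) = (combine t).2 := by
    intro t
    rw [combine_snd]
    refine Finset.sum_congr rfl fun B _ => ?_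
    simp only [Block.val_snd, Block.picture_fst]
    split_ifs <;> simp
  intro t t' _ _ htt
  rw [key, key, htt]

/-! ### Functions of the entries and their evaluation on codes -/

/-- The entries at four labels. -/
abbrev EntryFn : Type := Fin 8 → Fin 8 → Fin 8 → Fin 8 → ℕ

/-- Functions of a family and of entries. -/
abbrev Form : Type := Family → EntryFn → ℕ

/-- Precomposition of the entries with a map of labels. -/
def EntryFn.comp (w : EntryFn) (g : Fin 8 → Fin 8) : EntryFn :=
  fun i j k l => w (g i) (g j) (g k) (g l)

/-- The entries of a picture. -/
def Picture.entryFn (P : Picture) : EntryFn := fun i j k l => entry P {i, j, k, l}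

/-- The entries of the picture with code `c`. -/
def Code.entryFn (c : Code) : EntryFn := fun i j k l =>
  entryOfPairing c.1 (maskPairing c.2
    [Nat.lor (Nat.pow 2 i) (Nat.lor (Nat.pow 2 j) (Nat.lor (Nat.pow 2 k) (Nat.pow 2 l)))])

/-- The value of a form on a picture. -/
def Form.onPicture (φ : Form) (P : Picture) : ℤ := φ P.1 P.entryFn

/-- The value of a form on a code. -/
def Form.onCode (φ : Form) (c : Code) : ℕ := φ c.1 c.entryFn

/-- The form with its labels changed. -/
def Form.comp (φ : Form) (g : Fin 8 → Fin 8) : Form := fun f w => φ f (w.comp g)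

theorem Code.entryFn_picture {c : Code} (hc : c ∈ codes) : c.picture.entryFn = c.entryFn := by
  funext i j k l
  have hlt : ∀ i : Fin 8, 2 ^ (i : ℕ) < 2 ^ 8 := fun i => Nat.pow_lt_pow_right (by norm_num) i.2
  have h : ({i, j, k, l} : Finset (Fin 8)) =
      labelsOf (2 ^ (i : ℕ) ||| (2 ^ (j : ℕ) ||| (2 ^ (k : ℕ) ||| 2 ^ (l : ℕ)))) := by
    simp only [labelsOf_or, labelsOf_pow]
    rfl
  rw [Picture.entryFn, h, Code.entryFn, entry, ← setsOf_singleton, Code.picture,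
    pairing_setsOf (codes_isMaskList c hc) (isMaskList_singleton _)]
  · rfl
  · exact Nat.or_lt_two_pow (hlt i) (Nat.or_lt_two_pow (hlt j) (Nat.or_lt_two_pow (hlt k) (hlt l)))

theorem Form.onPicture_picture (φ : Form) {c : Code} (hc : c ∈ codes) :
    φ.onPicture c.picture = φ.onCode c := by
  rw [Form.onPicture, Form.onCode, Code.entryFn_picture hc]
  rfl

/-- Precomposing the entries with `g` amounts to relabelling the picture by the inverse of `g`. -/
theorem Determined.comp {φ : Form} (h : Determined φ.onPicture) {g : Fin 8 → Fin 8}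
    (hg : Function.Bijective g) : Determined (φ.comp g).onPicture := by
  let σ := Equiv.ofBijective g hg
  refine (h.relabel σ⁻¹).congr fun B => ?_
  have : (B.picture.relabel σ⁻¹).entryFn = B.picture.entryFn.comp g := by
    funext i j k l
    rw [Picture.entryFn, ← entry_relabel σ, Picture.relabel_relabel, mul_inv_cancel,
      Picture.relabel_one]
    simp only [Finset.map_insert, Finset.map_singleton]
    rfl
  rw [Form.onPicture, this]
  rfl

/-! ### Checks by enumeration of codes -/

/-- Evaluation of the continuation at the list of elements satisfying `p`. -/
def filterThen {α : Type} (p : α → Bool) (l : List α) : (List α → Bool) → Bool :=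
  List.rec (motive := fun _ => (List α → Bool) → Bool) (fun k => k [])
    (fun a _ ih k => bif p a then ih fun r => k (a :: r) else ih k) l

theorem filterThen_eq {α : Type} (p : α → Bool) (l : List α) (k : List α → Bool) :
    filterThen p l k = k (l.filter p) := by
  induction l generalizing k with
  | nil => rfl
  | cons a l ih =>
    change (bif p a then filterThen p l fun r => k (a :: r) else filterThen p l k) = _
    rw [ih, ih, List.filter_cons]
    cases p a <;> rfl

/-- Adjacency of the pictures with two given codes. -/
def adjCode (c d : Code) : Bool :=
  List.rec (motive := fun _ => Bool) false
    (fun k _ r => bif k.beq (maskPairing c.2 d.2) then true else r) (adjPairings c.1 d.1)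

theorem adjCode_eq (c d : Code) :
    adjCode c d = (adjPairings c.1 d.1).any fun k => k.beq (maskPairing c.2 d.2) := by
  rw [adjCode]
  induction adjPairings c.1 d.1 with
  | nil => rfl
  | cons k l ih =>
    rw [List.any_cons, ← ih]
    change (bif k.beq (maskPairing c.2 d.2) then true else _) = _
    cases k.beq (maskPairing c.2 d.2) <;> rfl

theorem adjCode_iff {c d : Code} (hc : c ∈ codes) (hd : d ∈ codes) :
    adjCode c d = true ↔ Adj c.picture d.picture := by
  simp only [adjCode_eq, Adj, Code.picture,
    pairing_setsOf (codes_isMaskList c hc) (codes_isMaskList d hd), List.any_eq_true, Nat.beq_eq,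
    exists_eq_right]

/-- Decision procedure for the coherence of two forms. -/
def coherentCheck (φ ψ : Form) : Bool :=
  filterThen (fun c => (φ.onCode c).blt (ψ.onCode c)) codes fun l =>
    filterThen (fun c => (ψ.onCode c).blt (φ.onCode c)) codes fun l' =>
      l.all fun c => l'.all fun d => !adjCode c d

theorem coherent_of_check {φ ψ : Form} (h : coherentCheck φ ψ = true) :
    Coherent φ.onPicture ψ.onPicture := by
  intro B B' hadj hlt hlt'
  obtain ⟨c, hc, hp⟩ := B.exists_code
  obtain ⟨d, hd, hp'⟩ := B'.exists_code
  rw [← hp, φ.onPicture_picture hc, ψ.onPicture_picture hc, Int.ofNat_lt] at hlt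
  rw [← hp', φ.onPicture_picture hd, ψ.onPicture_picture hd, Int.ofNat_lt] at hlt'
  rw [← hp, ← hp', ← adjCode_iff hc hd] at hadj
  rw [coherentCheck, filterThen_eq, filterThen_eq] at h
  have h1 := List.all_eq_true.1 h c (List.mem_filter.2 ⟨hc, blt_of_lt hlt⟩)
  have h2 := List.all_eq_true.1 h1 d (List.mem_filter.2 ⟨hd, blt_of_lt hlt'⟩)
  rw [hadj] at h2
  exact absurd h2 (by decide)

/-- The minimum, evaluated without the second argument if the first one is zero. -/
def lazyMin (a b : ℕ) : ℕ :=
  Nat.rec (motive := fun _ => ℕ) 0 (fun m _ => bif b.ble m then b else m + 1) a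

theorem lazyMin_eq (a b : ℕ) : lazyMin a b = min a b := by
  cases a with
  | zero => simp [lazyMin]
  | succ m =>
    change (bif b.ble m then b else m + 1) = _
    cases h : b.ble m
    · have : ¬ b ≤ m := fun h' => by rw [Nat.ble_eq_true_of_le h'] at h; cases h
      rw [cond_false, min_eq_left (by omega)]
    · have := Nat.le_of_ble_eq_true h
      rw [cond_true, min_eq_right (by omega)]

/-- The minimum of two forms. -/
def Form.min (φ ψ : Form) : Form := fun f w => lazyMin (φ f w) (ψ f w)

theorem Form.min_onPicture (φ ψ : Form) (P : Picture) :
    (φ.min ψ).onPicture P = Min.min (φ.onPicture P) (ψ.onPicture P) := by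
  simp only [Form.onPicture, Form.min, lazyMin_eq, Nat.cast_min]

theorem Determined.formMin {φ ψ : Form} (hφ : Determined φ.onPicture)
    (hψ : Determined ψ.onPicture) (h : coherentCheck φ ψ = true) :
    Determined (φ.min ψ).onPicture :=
  (hφ.min hψ (coherent_of_check h)).congr fun B => (Form.min_onPicture φ ψ B.picture).symm

/-! ### The gap in a three-term Plücker relation -/

/-- The terms of the three-term Plücker relation of six labels. -/
def term₁ : Form := fun _ w => w 0 1 2 3 + w 0 1 4 5

/-- The second term of this relation. -/
def term₂ : Form := fun _ w => w 0 1 2 4 + w 0 1 3 5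

/-- The third term of this relation. -/
def term₃ : Form := fun _ w => w 0 1 2 5 + w 0 1 3 4

/-- The amount by which the first term exceeds the minimum of the three terms. -/
def gap : Form := fun f w =>
  withNumeral (term₁ f w) fun a => withNumeral (term₂ f w) fun b =>
    withNumeral (term₃ f w) fun c => bif a.ble b then a - c else bif a.ble c then a - b else
      bif b.ble c then a - b else a - c

theorem coherent_terms : Coherent term₂.onPicture term₃.onPicture :=
  coherent_of_check (by decide +kernel)

theorem gap_eq (f : Family) (w : EntryFn) :
    gap f w = max (term₁ f w - term₂ f w) (term₁ f w - term₃ f w) := by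
  have hcond : ∀ (a b x y : ℕ), (bif a.ble b then x else y) = if a ≤ b then x else y := by
    intro a b x y
    by_cases h : a ≤ b
    · rw [Nat.ble_eq_true_of_le h, if_pos h, cond_true]
    · rw [if_neg h, Bool.eq_false_iff.2 fun h' => h (Nat.le_of_ble_eq_true h'), cond_false]
  simp only [gap, withNumeral_eq, hcond]
  split_ifs <;> omega

/-- Two of the three terms attain their minimum. -/
theorem term₁_not_lt (B : Block) : ¬ (term₁.onPicture B.picture < term₂.onPicture B.picture ∧
    term₁.onPicture B.picture < term₃.onPicture B.picture) := by
  have key : (codes.all fun c => (term₂.onCode c).ble (term₁.onCode c) ||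
    (term₃.onCode c).ble (term₁.onCode c)) = true := by decide +kernel
  obtain ⟨c, hc, hp⟩ := B.exists_code
  rw [← hp, Form.onPicture_picture _ hc, Form.onPicture_picture _ hc, Form.onPicture_picture _ hc]
  have := List.all_eq_true.1 key c hc
  rw [Bool.or_eq_true, Nat.ble_eq, Nat.ble_eq] at this
  omega

/-- All three terms involve the labels 0 and 1 twice and 2, 3, 4, 5 once, so the lineality shift
cancels in the difference of two of them. -/
theorem determined_term_sub {φ : Form} {S₁ S₂ : Quad}
    (hφ : ∀ P : Picture, φ.onPicture P = (entry P S₁.1 + entry P S₂.1 : ℕ))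
    (h : ∀ a : Fin 8 → ℚ, ∑ i ∈ S₁.1, a i + ∑ i ∈ S₂.1, a i =
      a 0 + a 1 + (a 0 + a 1 + a 2 + a 3 + a 4 + a 5)) :
    Determined fun P => φ.onPicture P - term₁.onPicture P := by
  refine (determined_entry S₁ S₂ ⟨{0, 1, 2, 3}, rfl⟩ ⟨{0, 1, 4, 5}, rfl⟩ fun a => ?_).congr
    fun B => by rw [hφ]; rfl
  rw [h]
  simp [Finset.sum_insert]
  ring

/-- The first term minus the smaller of the other two is determined, since the latter are coherent.
By `term₁_not_lt` this is also the excess over the minimum of all three. -/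
theorem determined_gap : Determined gap.onPicture := by
  have h₂ : Determined fun P => term₂.onPicture P - term₁.onPicture P := by
    refine determined_term_sub (S₁ := ⟨{0, 1, 2, 4}, rfl⟩) (S₂ := ⟨{0, 1, 3, 5}, rfl⟩)
      (fun P => rfl) fun a => ?_
    simp [Finset.sum_insert]
    ring
  have h₃ : Determined fun P => term₃.onPicture P - term₁.onPicture P := by
    refine determined_term_sub (S₁ := ⟨{0, 1, 2, 5}, rfl⟩) (S₂ := ⟨{0, 1, 3, 4}, rfl⟩)
      (fun P => rfl) fun a => ?_
    simp [Finset.sum_insert]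
    ring
  have hmin := h₂.min h₃ fun B B' hadj hlt hlt' => coherent_terms B B' hadj
    (by linarith) (by linarith)
  -- On blocks this minimum with 0 changes nothing: 0 is never strictly smaller, so coherence is
  -- vacuous. It matches the truncated subtraction in `gap`.
  have hmin' := determined_zero.min hmin fun B B' _ hlt _ => term₁_not_lt B
    (by have := lt_min_iff.1 hlt; constructor <;> linarith)
  refine (hmin'.mul (-1)).congr fun B => ?_
  simp only [Form.onPicture, gap_eq]
  omega

/-- The weight of the split of six labels into a pair and a quadruple. -/
def split : Form :=
  (gap.min (gap.comp ![0, 1, 2, 3, 4, 6, 5, 7])).min (gap.comp ![0, 1, 2, 3, 4, 7, 6, 5])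

/-- The minimum of the weights of two splits of a quadruple. -/
def quadGap : Form := split.min (split.comp ![0, 2, 1, 3, 4, 5, 6, 7])

/-- The minimum of the weights of two splits with the same pair. -/
def pairGap : Form := split.min (split.comp ![0, 4, 2, 3, 1, 5, 6, 7])

theorem determined_split : Determined split.onPicture := by
  refine Determined.formMin (Determined.formMin determined_gap
    (determined_gap.comp (by decide)) ?_) (determined_gap.comp (by decide)) ?_ <;>
  decide +kernel

/-- The splits are those of 23 seen from 01 and of 13 seen from 02, in both cases against 4567. -/
theorem determined_quadGap : Determined quadGap.onPicture :=
  determined_split.formMin (determined_split.comp (by decide)) (by decide +kernel)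

theorem determined_pairGap : Determined pairGap.onPicture :=
  determined_split.formMin (determined_split.comp (by decide)) (by decide +kernel)

/-! ### The coefficients of the pictures -/

/-- The coefficient of the picture `P` is determined by the valuation data. -/
def Known (P : Picture) : Prop := Determined fun Q => if Q = P then 1 else 0

theorem Known.relabel {P : Picture} (h : Known P) (σ : Equiv.Perm (Fin 8)) :
    Known (P.relabel σ) := by
  refine (Determined.relabel h σ⁻¹).congr fun B => ?_
  have : B.picture.relabel σ⁻¹ = P ↔ B.picture = P.relabel σ := by
    constructor
    · rintro rfl
      rw [Picture.relabel_relabel, mul_inv_cancel, Picture.relabel_one]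
    · intro h
      rw [h, Picture.relabel_relabel, inv_mul_cancel, Picture.relabel_one]
  simp only [this]

theorem total_eq_sum {t : Block →₀ ℚ} (f : Picture → ℤ) {s : Finset Picture}
    (hs : ∀ B ∈ t.support, B.picture ∈ s) :
    total t f = ∑ P ∈ s, f P * total t fun Q => if Q = P then 1 else 0 := by
  simp only [total, Finsupp.sum, Finset.mul_sum]
  rw [Finset.sum_comm]
  refine Finset.sum_congr rfl fun B hB => ?_
  rw [Finset.sum_eq_single_of_mem _ (hs B hB)]
  · simp [mul_comm]
  · intro P _ hP
    rw [if_neg (Ne.symm hP)]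
    simp

/-- The total of `f` is a sum over pictures, and each picture with a nonzero value of `f`
contributes a known coefficient. -/
theorem determined_of_known {f : Picture → ℤ}
    (h : ∀ B : Block, f B.picture ≠ 0 → Known B.picture) : Determined f := by
  intro t t' ht ht' htt
  set s := (t.support ∪ t'.support).image Block.picture with hs
  rw [total_eq_sum (s := s) f fun B hB => Finset.mem_image_of_mem _ (Finset.mem_union_left _ hB),
    total_eq_sum (s := s) f fun B hB => Finset.mem_image_of_mem _ (Finset.mem_union_right _ hB)]
  refine Finset.sum_congr rfl fun P hP => ?_
  obtain ⟨B, -, rfl⟩ := Finset.mem_image.1 hP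
  by_cases hf : f B.picture = 0
  · rw [hf]
    simp
  · rw [h B hf t t' ht ht' htt]

/-- The form that agrees with `φ` on the families satisfying `p` and is zero on the others. -/
def Form.restrict (φ : Form) (p : Family → Bool) : Form := fun f w => bif p f then φ f w else 0

/-- The part of `φ` on the discarded families is a combination of known coefficients, hence
determined, and can be subtracted. -/
theorem Determined.restrict {φ : Form} (hφ : Determined φ.onPicture) {p : Family → Bool}
    (h : ∀ B : Block, p B.kind.family = false → Known B.picture) :
    Determined (φ.restrict p).onPicture := by
  have h0 : Determined (φ.restrict fun f => !p f).onPicture := by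
    refine determined_of_known fun B hB => h B ?_
    by_contra hp
    rw [Bool.not_eq_false] at hp
    exact hB (by simp [Form.onPicture, Form.restrict, Block.picture_fst, hp])
  refine (hφ.sub h0).congr fun B => ?_
  simp only [Form.onPicture, Form.restrict]
  cases p B.picture.1 <;> simp

/-- The check ensures that the truncated subtraction is an honest one on every picture. -/
theorem Determined.formSub {φ ψ : Form} (hφ : Determined φ.onPicture)
    (hψ : Determined ψ.onPicture)
    (h : (codes.all fun c => (ψ.onCode c).ble (φ.onCode c)) = true) :
    Determined (Form.onPicture fun f w => φ f w - ψ f w) := by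
  refine (hφ.sub hψ).congr fun B => ?_
  obtain ⟨c, hc, hp⟩ := B.exists_code
  have h1 := Nat.le_of_ble_eq_true (List.all_eq_true.1 h c hc)
  rw [← hp, Form.onPicture_picture _ hc, Form.onPicture_picture _ hc, Form.onPicture_picture _ hc,
    ← Nat.cast_sub h1]
  rfl

/-- A form that vanishes on every picture but one is a positive multiple of the indicator of that
picture. -/
theorem known_of_form {φ : Form} (hφ : Determined φ.onPicture) {c : Code}
    (h : filterThen (fun d => Nat.blt 0 (φ.onCode d)) codes (fun l => decide (l = [c])) = true) :
    Known c.picture := by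
  rw [filterThen_eq, decide_eq_true_iff] at h
  have hmem : ∀ d, d ∈ codes ∧ 0 < φ.onCode d ↔ d = c := by
    intro d
    rw [← List.mem_singleton, ← h, List.mem_filter, Nat.blt_eq]
  obtain ⟨hc, hpos⟩ := (hmem c).2 rfl
  refine Determined.of_mul (k := φ.onCode c) (by exact_mod_cast hpos.ne') (hφ.congr fun B => ?_)
  by_cases hB : B.picture = c.picture
  · rw [hB, if_pos rfl, φ.onPicture_picture hc, mul_one]
  · rw [if_neg hB, mul_zero]
    obtain ⟨d, hd, hp⟩ := B.exists_code
    rw [← hp, φ.onPicture_picture hd]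
    by_contra hne
    exact hB (by rw [← hp, (hmem d).1 ⟨hd, by omega⟩])

/-- Relabelling acts transitively on the pictures of a family, so one known picture suffices. The
map `σ` carries the standard picture to it. -/
theorem known_family {f : Family} {P : Picture} (hP : Known P) (σ : Fin 8 → Fin 8)
    (hσ : ∀ i j, σ i = σ j → i = j)
    (h : P = (f.stdPicture.1, f.stdPicture.2.image fun T => T.image σ)) :
    ∀ B : Block, B.kind.family = f → Known B.picture := by
  rintro B rfl
  let τ := Equiv.ofBijective σ (Finite.injective_iff_bijective.1 fun i j => hσ i j)
  have hP' : P = B.kind.family.stdPicture.relabel τ := by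
    rw [h, Picture.relabel]
    congr 2
    funext T
    rw [Finset.map_eq_image]
    rfl
  have := hP.relabel (B.label * τ⁻¹)
  rwa [hP', Picture.relabel_relabel, inv_mul_cancel_right] at this

theorem determined_min_pairGap {g : Fin 8 → Fin 8} (hg : Function.Bijective g)
    (h : coherentCheck pairGap (pairGap.comp g) = true) :
    Determined (pairGap.min (pairGap.comp g)).onPicture :=
  determined_pairGap.formMin (determined_pairGap.comp hg) h

theorem known_alpha1 : ∀ B : Block, B.kind.family = .alpha1 → Known B.picture := by
  refine known_family (known_of_form (c := (.alpha1, [12])) (determined_min_pairGap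
    (g := ![1, 4, 2, 3, 5, 0, 6, 7]) (by decide) ?_) ?_) ![2, 3, 0, 1, 4, 5, 6, 7] ?_ ?_ <;>
  decide +kernel

theorem determined_restrict_min_pairGap {g : Fin 8 → Fin 8} (hg : Function.Bijective g)
    (h : coherentCheck pairGap (pairGap.comp g) = true) :
    Determined ((pairGap.min (pairGap.comp g)).restrict
      (Family.table false true true true true true true true true)).onPicture := by
  refine (determined_min_pairGap hg h).restrict fun B hB => known_alpha1 B ?_
  cases hf : B.kind.family <;> rw [hf] at hB <;> first | rfl | exact absurd hB (by decide)

theorem known_chi1 : ∀ B : Block, B.kind.family = .chi1 → Known B.picture := by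
  refine known_family (known_of_form (c := (.chi1, [12, 97, 146])) (determined_restrict_min_pairGap
    (g := ![1, 5, 2, 3, 6, 0, 4, 7]) (by decide) ?_) ?_) ![2, 3, 0, 5, 6, 1, 4, 7] ?_ ?_ <;>
  decide +kernel

theorem known_chi2 : ∀ B : Block, B.kind.family = .chi2 → Known B.picture := by
  refine known_family (known_of_form (c := (.chi2, [13])) (determined_restrict_min_pairGap
    (g := ![0, 5, 2, 3, 6, 1, 4, 7]) (by decide) ?_) ?_) ![0, 2, 3, 1, 4, 5, 6, 7] ?_ ?_ <;>
  decide +kernel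

theorem known_phi2 : ∀ B : Block, B.kind.family = .phi2 → Known B.picture := by
  refine known_family (known_of_form (c := (.phi2, [12, 19, 224])) (determined_restrict_min_pairGap
    (g := ![1, 0, 2, 3, 4, 5, 6, 7]) (by decide) ?_) ?_) ![0, 1, 4, 2, 3, 5, 6, 7] ?_ ?_ <;>
  decide +kernel

theorem determined_phi1_pairGap : Determined (pairGap.restrict
    (Family.table false true false false true false true true true)).onPicture := by
  refine determined_pairGap.restrict fun B hB => ?_
  cases hf : B.kind.family <;> rw [hf] at hB <;>
    first
      | exact known_alpha1 B hf
      | exact known_chi1 B hf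
      | exact known_chi2 B hf
      | exact known_phi2 B hf
      | exact absurd hB (by decide)

theorem known_phi1 : ∀ B : Block, B.kind.family = .phi1 → Known B.picture := by
  refine known_family (known_of_form (c := (.phi1, [12, 96, 18, 129, 108, 147]))
    (determined_phi1_pairGap.formMin (determined_phi1_pairGap.comp
    (g := ![0, 1, 5, 6, 4, 2, 3, 7]) (by decide)) ?_) ?_) ![0, 7, 1, 4, 2, 3, 5, 6] ?_ ?_ <;>
  decide +kernel

/-! ### The families φ₃, Line and α₂, which mark two quadruples -/

/-- The minimum of the weights of two splits of a quadruple with a pair in common. -/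
def quadBlock : Form := quadGap.min (quadGap.comp ![1, 0, 2, 3, 4, 5, 6, 7])

/-- The form involves all three ways of splitting 0123 into two pairs; it detects exactly α₂ and φ₃
of 0123|4567. -/
theorem determined_quadBlock : Determined quadBlock.onPicture :=
  determined_quadGap.formMin (determined_quadGap.comp (by decide)) (by decide +kernel)

/-- The part of the gap that comes from the families that mark two quadruples. -/
def quadPart : Form :=
  gap.restrict (Family.table false true false false false false true true true)

theorem determined_quadPart : Determined quadPart.onPicture := by
  refine determined_gap.restrict fun B hB => ?_
  cases hf : B.kind.family <;> rw [hf] at hB <;>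
    first
      | exact known_alpha1 B hf
      | exact known_chi1 B hf
      | exact known_chi2 B hf
      | exact known_phi1 B hf
      | exact known_phi2 B hf
      | exact absurd hB (by decide)

/-- The part of the gap that comes from four quadruples. -/
def crossPart : Form := fun f w =>
  quadPart f w - quadBlock f w - (quadBlock.comp ![0, 1, 4, 5, 2, 3, 6, 7]) f w

/-- The gap of 23|45 seen from 01 also registers α₂ and φ₃ of 0123 and of 0145, removed here. What
remains comes from φ₃ and Line of the four partitions into quadruples that separate 0 from 1, 6 from
7 and the pair 23 from the pair 45. -/
theorem determined_crossPart : Determined crossPart.onPicture := by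
  refine Determined.formSub (φ := fun f w => quadPart f w - quadBlock f w)
    (determined_quadPart.formSub determined_quadBlock ?_)
    (determined_quadBlock.comp (g := ![0, 1, 4, 5, 2, 3, 6, 7]) (by decide)) ?_ <;>
  decide +kernel

/-- The contribution to the gap of the families `φ₃` and `Line` with a given quadruple. -/
def crossBlock : Form := crossPart.min (crossPart.comp ![2, 7, 0, 3, 4, 1, 5, 6])

/-- The second gap is that of 03|14 seen from 27. Among the four partitions belonging to each of the
two gaps, only 0236|1457 is common. -/
theorem determined_crossBlock : Determined crossBlock.onPicture :=
  determined_crossPart.formMin (determined_crossPart.comp (by decide)) (by decide +kernel)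

/-- Of the blocks attached to 0236|1457, `crossBlock` sees φ₃ and Line, and the relabelled
`quadBlock` sees φ₃ and α₂; their minimum isolates φ₃. -/
theorem known_phi3 : ∀ B : Block, B.kind.family = .phi3 → Known B.picture := by
  refine known_family (known_of_form (c := (.phi3, [77, 178])) (determined_crossBlock.formMin
    (determined_quadBlock.comp (g := ![0, 2, 3, 6, 1, 4, 5, 7]) (by decide)) ?_) ?_)
    ![0, 2, 3, 6, 1, 4, 5, 7] ?_ ?_ <;>
  decide +kernel

theorem determined_restrict_phi3 {φ : Form} (hφ : Determined φ.onPicture) : Determined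
    (φ.restrict (Family.table true true true true true true false true true)).onPicture := by
  refine hφ.restrict fun B hB => known_phi3 B ?_
  cases hf : B.kind.family <;> rw [hf] at hB <;> first | rfl | exact absurd hB (by decide)

theorem known_line : ∀ B : Block, B.kind.family = .line → Known B.picture := by
  refine known_family (known_of_form (c := (.line, [77, 178]))
    (determined_restrict_phi3 determined_crossBlock) ?_) ![0, 2, 3, 6, 1, 4, 5, 7] ?_ ?_ <;>
  decide +kernel

theorem known_alpha2 : ∀ B : Block, B.kind.family = .alpha2 → Known B.picture := by
  refine known_family (known_of_form (c := (.alpha2, [15, 240]))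
    (determined_restrict_phi3 determined_quadBlock) ?_) ![0, 1, 2, 3, 4, 5, 6, 7] ?_ ?_ <;>
  decide +kernel

/-- The valuation data determines the coefficient of each picture. -/
theorem known_picture (B : Block) : Known B.picture := by
  cases hf : B.kind.family
  · exact known_alpha1 B hf
  · exact known_alpha2 B hf
  · exact known_chi1 B hf
  · exact known_chi2 B hf
  · exact known_phi1 B hf
  · exact known_phi2 B hf
  · exact known_phi3 B hf
  -- TCu has a single picture and is the only block with nonzero †-entry, so this entry of the
  -- valuation data is its coefficient.
  · refine determined_tcu.congr fun B' => ?_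
    have h : B'.picture.1 = .tcu ↔ B'.picture = B.picture := by
      have hB : B.picture = (.tcu, ∅) := by
        obtain ⟨k, σ⟩ := B
        cases k <;> first | exact Family.noConfusion hf | rfl
      rw [hB]
      obtain ⟨k, σ⟩ := B'
      cases k <;> simp [Block.picture, Kind.family, Family.stdPicture, Picture.relabel, picTCu,
        picAlpha1, picAlpha2, picChi1, picChi2, picPhi1, picPhi2, picPhi3, picLine]
    simp only [h]
  · exact known_line B hf

/-! ### Uniqueness of the coefficients of the pictures -/

/-- Check that the pictures auxiliary to the standard picture of the family `f` are adjacent to the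
pictures compatible with it. -/
def auxCheck (f : Family) : Bool :=
  filterThen (fun c => (auxPairings f c.1).any fun k => k.beq (maskPairing (stdMasks f) c.2))
    codes fun l => filterThen
      (fun c => (symmCompatPairings f c.1).any fun k => k.beq (maskPairing (stdMasks f) c.2))
      codes fun l' => l.all fun c => l'.all fun d => adjCode c d

theorem auxCheck_eq_true (f : Family) : auxCheck f = true := by
  cases f <;> decide +kernel

/-- The auxiliary blocks of a block are adjacent to the blocks compatible with it. -/
theorem adj_of_isAuxiliaryTo_of_compatible {b B R : Block}
    (hb : IsAuxiliaryTo b.picture B.picture) (hR : CompatiblePictures B.picture R.picture) :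
    Adj b.picture R.picture := by
  have h1 := mem_auxPairings_of_isAuxiliaryTo hb
  have h2 := mem_symmCompatPairings_of_compatible hR
  -- Undoing the label of `B` moves `B` to the standard picture, where `auxCheck` applies.
  obtain ⟨c, hc, hcb⟩ := (Block.relabelEquiv B.label⁻¹ b).exists_code
  obtain ⟨d, hd, hdR⟩ := (Block.relabelEquiv B.label⁻¹ R).exists_code
  have hrel : ∀ C : Block,
      C.picture = (Block.relabelEquiv B.label⁻¹ C).picture.relabel B.label := fun C => by
    rw [Block.picture_relabelEquiv, Picture.relabel_relabel, mul_inv_cancel, Picture.relabel_one]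
  have hmem : ∀ C : Block, ∀ c ∈ codes, c.picture = (Block.relabelEquiv B.label⁻¹ C).picture →
      ∀ l : List ℕ, pairing B.picture.2 C.picture.2 ∈ l →
        (l.any fun k => k.beq (maskPairing (stdMasks B.kind.family) c.2)) = true := by
    intro C c hc hcC l hl
    rw [hrel C, ← hcC, Block.picture, pairing_relabel, ← setsOf_stdMasks] at hl
    rw [← pairing_setsOf (isMaskList_stdMasks _) (codes_isMaskList c hc)]
    exact List.any_eq_true.2 ⟨_, hl, Nat.beq_refl _⟩
  have hfst : ∀ C : Block, ∀ c : Code, c.picture = (Block.relabelEquiv B.label⁻¹ C).picture →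
      C.picture.1 = c.1 := by
    intro C c hcC
    rw [hrel C, ← hcC]
    rfl
  have h := auxCheck_eq_true B.kind.family
  rw [auxCheck, filterThen_eq, filterThen_eq] at h
  rw [Block.picture_fst, hfst b c hcb] at h1
  rw [Block.picture_fst, hfst R d hdR] at h2
  have h3 := List.all_eq_true.1 (List.all_eq_true.1 h c
    (List.mem_filter.2 ⟨hc, hmem b c hc hcb _ h1⟩)) d (List.mem_filter.2 ⟨hd, hmem R d hd hdR _ h2⟩)
  rw [adjCode_iff hc hd, hcb, hdR] at h3
  rw [hrel b, hrel R]
  exact h3.relabel _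

/-- Pictures of auxiliary blocks do not have auxiliary blocks themselves. -/
theorem IsAuxiliaryTo.not_isAuxiliaryTo {P Q R : Picture} (h : IsAuxiliaryTo P Q) :
    ¬ IsAuxiliaryTo R P := by
  intro h'
  have h1 := mem_auxPairings_of_isAuxiliaryTo h
  have h2 := mem_auxPairings_of_isAuxiliaryTo h'
  have key : ∀ f g k : Family, auxPairings f g ≠ [] → auxPairings g k = [] := by
    intro f g k
    cases f <;> cases g <;> cases k <;> decide
  rw [key _ _ _ (List.ne_nil_of_mem h1)] at h2
  exact absurd h2 List.not_mem_nil

/-- The sum of the coefficients of the blocks with picture `P`. -/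
def pictureCoeff (t : Block →₀ ℚ) (P : Picture) : ℚ := total t fun Q => if Q = P then 1 else 0

theorem pictureCoeff_eq_zero {t : Block →₀ ℚ} {P : Picture}
    (h : ∀ B ∈ t.support, B.picture ≠ P) : pictureCoeff t P = 0 :=
  Finset.sum_eq_zero fun B hB => by simp [h B hB]

theorem pictureCoeff_nonneg {t : Block →₀ ℚ} (ht : ∀ B, 0 ≤ t B) (P : Picture) :
    0 ≤ pictureCoeff t P := by
  refine Finset.sum_nonneg fun B _ => mul_nonneg (ht B) ?_
  beta_reduce
  split_ifs <;> simp

theorem pictureCoeff_pos {t : Block →₀ ℚ} (ht : ∀ B, 0 ≤ t B) {B : Block} (hB : B ∈ t.support) :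
    0 < pictureCoeff t B.picture := by
  refine Finset.sum_pos' (fun C _ => mul_nonneg (ht C) ?_) ⟨B, hB, ?_⟩
  · beta_reduce
    split_ifs <;> simp
  · simpa using lt_of_le_of_ne (ht B) (Ne.symm (Finsupp.mem_support_iff.1 hB))

theorem pictureCoeff_add (t t' : Block →₀ ℚ) (P : Picture) :
    pictureCoeff (t + t') P = pictureCoeff t P + pictureCoeff t' P := by
  unfold pictureCoeff total
  exact Finsupp.sum_add_index' (fun _ => zero_mul _) fun _ _ _ => add_mul _ _ _

namespace IsCompatibleBlockDecomposition

variable {v : ValData} {m l : Block →₀ ℚ}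

theorem isAdmissible (h : IsCompatibleBlockDecomposition v m l) : IsAdmissible (m + l) := by
  have hml : ∀ b ∈ l.support, ∀ R ∈ m.support, Adj b.picture R.picture := by
    intro b hb R hR
    obtain ⟨B, hB, haux⟩ := h.isAuxiliary b hb
    exact adj_of_isAuxiliaryTo_of_compatible haux (h.compatible B hB R hR)
  refine ⟨fun B => add_nonneg (h.main_nonneg B) (h.aux_nonneg B), fun B hB B' hB' => ?_⟩
  rcases Finset.mem_union.1 (Finsupp.support_add hB) with hB | hB <;>
    rcases Finset.mem_union.1 (Finsupp.support_add hB') with hB' | hB'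
  · exact adj_of_compatible (h.compatible B hB B' hB')
  · exact (hml B' hB' B hB).symm
  · exact hml B hB B' hB'
  · exact adj_of_compatible (Or.inl (h.aux_samePicture B hB B' hB'))

theorem combine_eq (h : IsCompatibleBlockDecomposition v m l) : combine (m + l) = v := by
  rw [h.eq_sum]
  exact Finsupp.sum_add_index' (fun _ => zero_smul _ _) fun _ _ _ => add_smul _ _ _

/-- The right-hand side involves only the total `m + l`, so the separation into main and auxiliary
parts is itself determined by the total coefficients. -/
theorem pictureCoeff_aux (h : IsCompatibleBlockDecomposition v m l) (P : Picture) :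
    pictureCoeff l P = open scoped Classical in
      if ∃ B : Block, pictureCoeff (m + l) B.picture ≠ 0 ∧ IsAuxiliaryTo P B.picture then
        pictureCoeff (m + l) P else 0 := by
  split_ifs with hP
  · obtain ⟨B, hB, haux⟩ := hP
    rw [pictureCoeff_add, right_eq_add]
    -- If the picture of `B` occurred only among the auxiliary blocks, it would be auxiliary and at
    -- the same time have `P` as an auxiliary picture.
    obtain ⟨C, hC, hCB⟩ : ∃ C ∈ m.support, C.picture = B.picture := by
      by_contra! hno
      refine hB ?_
      rw [pictureCoeff_add, pictureCoeff_eq_zero hno, pictureCoeff_eq_zero, add_zero]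
      intro b hb hbB
      obtain ⟨D, -, hD⟩ := h.isAuxiliary b hb
      rw [hbB] at hD
      exact hD.not_isAuxiliaryTo haux
    -- A main block with picture `P` would have to be compatible with the block `C` to which `P` is
    -- auxiliary.
    refine pictureCoeff_eq_zero fun D hD hDP => ?_
    rw [← hDP, ← hCB] at haux
    exact not_compatible_of_isAuxiliaryTo haux (h.compatible D hD C hC)
  · refine pictureCoeff_eq_zero fun b hb hbP => hP ?_
    obtain ⟨B, hB, haux⟩ := h.isAuxiliary b hb
    refine ⟨B, ?_, hbP ▸ haux⟩
    rw [pictureCoeff_add]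
    refine (add_pos_of_pos_of_nonneg (pictureCoeff_pos h.main_nonneg hB)
      (pictureCoeff_nonneg h.aux_nonneg _)).ne'

theorem pictureCoeff_unique {m' l' : Block →₀ ℚ} (h : IsCompatibleBlockDecomposition v m l)
    (h' : IsCompatibleBlockDecomposition v m' l') (B : Block) :
    pictureCoeff m B.picture = pictureCoeff m' B.picture ∧
      pictureCoeff l B.picture = pictureCoeff l' B.picture := by
  have hT : ∀ B : Block,
      pictureCoeff (m + l) B.picture = pictureCoeff (m' + l') B.picture := fun B =>
    known_picture B _ _ h.isAdmissible h'.isAdmissible (h.combine_eq.trans h'.combine_eq.symm)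
  have hl : pictureCoeff l B.picture = pictureCoeff l' B.picture := by
    rw [h.pictureCoeff_aux, h'.pictureCoeff_aux]
    classical exact if_congr (exists_congr fun C => by rw [hT]) (hT B) rfl
  refine ⟨?_, hl⟩
  have := hT B
  rw [pictureCoeff_add, pictureCoeff_add, hl] at this
  exact add_right_cancel this

end IsCompatibleBlockDecomposition

/-! ### Projective equivalence of valuation data -/

section PGL

variable {L : Type*} [Field L]

theorem addValuation_prod (ν : AddValuation L (WithTop ℚ)) {ι : Type*} (s : Finset ι) (f : ι → L) :
    ν (∏ i ∈ s, f i) = ∑ i ∈ s, ν (f i) := by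
  classical
  induction s using Finset.induction_on with
  | empty => simp
  | insert i s hi ih => rw [Finset.prod_insert hi, Finset.sum_insert hi, ν.map_mul, ih]

theorem exists_embedding (S : Quad) : ∃ e : Fin 4 ↪ Fin 8, Finset.univ.map e = S.1 :=
  ⟨(S.1.orderEmbOfFin S.2).toEmbedding, by simp⟩

theorem plucker_smul_mulVec (x : Fin 8 → Fin 4 → L) (a : Fin 8 → L) (N : Matrix (Fin 4) (Fin 4) L)
    (e : Fin 4 → Fin 8) :
    plucker (fun i => a i • N.mulVec (x i)) e = N.det * plucker x e * ∏ c, a (e c) := by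
  rw [plucker, plucker, ← Matrix.det_mul, ← Matrix.det_diagonal, ← Matrix.det_mul]
  congr 1
  ext r c
  rw [Matrix.mul_diagonal]
  simp [Matrix.mul_apply, Matrix.mulVec, dotProduct, mul_comm]

/-- Cramer's rule: if four of the points are the standard basis, the coordinates of every other
point are Plücker coordinates. -/
theorem plucker_update {z : Fin 8 → Fin 4 → L} {e : Fin 4 → Fin 8}
    (hz : ∀ c, z (e c) = Pi.single c 1) (i : Fin 8) (r : Fin 4) :
    plucker z (Function.update e r i) = z i r := by
  have h := Matrix.cramer_apply (1 : Matrix (Fin 4) (Fin 4) L) (z i) r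
  rw [Matrix.cramer_one, Module.End.one_apply] at h
  rw [h, plucker]
  congr 1
  ext s c
  rw [Matrix.of_apply, Matrix.updateCol_apply, Function.update_apply]
  split_ifs
  · rfl
  · rw [hz, Matrix.one_apply, Pi.single_apply]

/-- With integral coordinates, each term of the determinant has a coordinate of the chosen column as
a factor. -/
theorem inf_valuation_le_plucker (ν : AddValuation L (WithTop ℚ)) {z : Fin 8 → Fin 4 → L}
    (hz : ∀ i r, 0 ≤ ν (z i r)) (e : Fin 4 → Fin 8) (c : Fin 4) :
    (Finset.univ.inf fun r => ν (z (e c) r)) ≤ ν (plucker z e) := by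
  rw [plucker, Matrix.det_apply]
  refine ν.map_le_sum fun σ _ => ?_
  have hsign : ν (Equiv.Perm.sign σ • ∏ c, z (e c) (σ c)) = ∑ c, ν (z (e c) (σ c)) := by
    rw [← addValuation_prod]
    rcases Int.units_eq_one_or (Equiv.Perm.sign σ) with h | h <;> rw [h]
    · rw [one_smul]
    · rw [Units.neg_smul, one_smul, ν.map_neg]
  simp only [Matrix.of_apply]
  rw [hsign]
  exact (Finset.inf_le (Finset.mem_univ (σ c))).trans (Finset.single_le_sum
    (f := fun c => ν (z (e c) (σ c))) (fun c _ => hz _ _) (Finset.mem_univ c))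

/-- Rescaling the points by elements of valuation `a i` turns `w` into `w'`, but may spoil the
normalisation of the lifts. Moving four points with `w'`-entry 0 to the standard basis repairs this:
the coordinates become Plücker coordinates, so `hnonneg` makes them integral and `hzero` makes their
minimum 0. -/
theorem exists_isPluckerData_smul {ν : AddValuation L (WithTop ℚ)}
    (hν : ∀ q : ℚ, ∃ y : L, ν y = q) {w w' : Quad → ℚ} {a : Fin 8 → ℚ}
    (hw : ∀ S, w' S = w S + ∑ i ∈ S.1, a i) (hnonneg : ∀ S, 0 ≤ w' S)
    (hzero : ∀ i, ∃ S : Quad, i ∈ S.1 ∧ w' S = 0) {O : Octad L} (hO : IsPluckerData ν O w) :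
    ∃ g : LinearMap.GeneralLinearGroup L (Fin 4 → L), IsPluckerData ν (fun i => g • O i) w' := by
  obtain ⟨x, hx, hxw⟩ := hO
  choose y hy using fun i => hν (a i)
  have hne : ∀ {y : L} {q : ℚ}, ν y = q → y ≠ 0 := by
    rintro y q h rfl
    rw [ν.map_zero] at h
    exact WithTop.coe_ne_top h.symm
  obtain ⟨S₀, -, hS₀⟩ := hzero 0
  obtain ⟨e₀, he₀⟩ := exists_embedding S₀
  have hS₀' : (⟨Finset.univ.map e₀, by rw [Finset.card_map, Finset.card_fin]⟩ : Quad) = S₀ :=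
    Subtype.ext he₀
  set M : Matrix (Fin 4) (Fin 4) L := Matrix.of fun r c => x (e₀ c) r with hM
  have hMν : ν M.det = (w S₀ : ℚ) := by
    have := hxw e₀
    rwa [hS₀'] at this
  have hMdet : IsUnit M.det := (hne hMν).isUnit
  -- With this choice the rescaled points of `S₀` become the standard basis, and `N` has determinant
  -- of valuation `-w' S₀ = 0`, so it does not change Plücker valuations.
  set N : Matrix (Fin 4) (Fin 4) L := Matrix.diagonal (fun r => (y (e₀ r))⁻¹) * M⁻¹ with hN
  have hyne : ∀ i, y i ≠ 0 := fun i => hne (hy i)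
  have hdet : N.det * (M.det * ∏ c, y (e₀ c)) = 1 := by
    rw [hN, Matrix.det_mul, Matrix.det_diagonal, Finset.prod_inv_distrib, Matrix.det_nonsing_inv,
      Ring.inverse_eq_inv']
    have := Finset.prod_ne_zero_iff.2 fun c (_ : c ∈ Finset.univ) => hyne (e₀ c)
    have := hMdet.ne_zero
    field_simp
  have hNdet : IsUnit N.det := IsUnit.of_mul_eq_one _ hdet
  have hsum : ∀ e : Fin 4 ↪ Fin 8, ν (∏ c, y (e c)) = ((∑ i ∈ Finset.univ.map e, a i : ℚ)) := by
    intro e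
    rw [addValuation_prod, Finset.sum_map, WithTop.coe_sum]
    exact Finset.sum_congr rfl fun c _ => hy _
  have hNν : ν N.det = 0 := by
    have h := congrArg ν hdet
    rw [ν.map_mul, ν.map_mul, hMν, hsum, he₀, ← WithTop.coe_add, ← hw, hS₀, ν.map_one,
      WithTop.coe_zero, add_zero] at h
    exact h
  set z : Fin 8 → Fin 4 → L := fun i => y i • N.mulVec (x i) with hz
  have hplucker : HasPluckerValuations ν z w' := by
    intro e
    rw [hz, plucker_smul_mulVec, ν.map_mul, ν.map_mul, hNν, zero_add, hxw e, hsum e,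
      ← WithTop.coe_add, hw]
  have hbasis : ∀ c, z (e₀ c) = Pi.single c 1 := by
    intro c
    have hcol : x (e₀ c) = M.mulVec (Pi.single c 1) := by
      rw [Matrix.mulVec_single_one]
      rfl
    rw [hz]
    simp only
    rw [hcol, Matrix.mulVec_mulVec, hN, Matrix.mul_assoc, Matrix.nonsing_inv_mul _ hMdet,
      Matrix.mul_one, Matrix.diagonal_mulVec_single, ← Pi.single_smul, smul_eq_mul, mul_one,
      mul_inv_cancel₀ (hyne _)]
  have hint : ∀ i r, 0 ≤ ν (z i r) := by
    intro i r
    -- If `i` is in `S₀`, the updated tuple may repeat a label and so have no prescribed valuation;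
    -- the point is then a basis vector.
    by_cases hi : i ∈ Set.range e₀
    · obtain ⟨c, rfl⟩ := hi
      rw [hbasis, Pi.single_apply]
      split_ifs <;> simp
    · have hinj : Function.Injective (Function.update e₀ r i) := by
        intro c d hcd
        rw [Function.update_apply, Function.update_apply] at hcd
        split_ifs at hcd with h1 h2 h2
        · rw [h1, h2]
        · exact absurd ⟨d, hcd.symm⟩ hi
        · exact absurd ⟨c, hcd⟩ hi
        · exact e₀.injective hcd
      rw [← plucker_update hbasis, ← Function.Embedding.coeFn_mk _ hinj, hplucker]
      exact WithTop.coe_nonneg.2 (hnonneg _)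
  let g : LinearMap.GeneralLinearGroup L (Fin 4 → L) :=
    Units.map (Matrix.toLinAlgEquiv' : Matrix (Fin 4) (Fin 4) L ≃ₐ[L] _).toRingEquiv.toMonoidHom
      (N.nonsingInvUnit hNdet)
  have hg : ∀ u : Fin 4 → L, g • u = N.mulVec u := fun u => rfl
  refine ⟨g, z, ⟨fun i => ?_, fun i => le_antisymm ?_ (Finset.le_inf fun r _ => hint i r)⟩,
    hplucker⟩
  · obtain ⟨hxi, hxO⟩ := hx.lift i
    have hgx : g • x i ≠ 0 := (smul_ne_zero_iff_ne g).2 hxi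
    have hzi : z i = y i • g • x i := rfl
    refine ⟨hzi ▸ smul_ne_zero (hyne i) hgx, ?_⟩
    rw [← hxO, Projectivization.smul_mk, Projectivization.mk_eq_mk_iff']
    exact ⟨y i, hzi.symm⟩
  -- A Plücker coordinate of valuation 0 involving `i` bounds the minimal valuation of the
  -- coordinates of `z i` from above.
  · obtain ⟨S, hiS, hS⟩ := hzero i
    obtain ⟨e, he⟩ := exists_embedding S
    obtain ⟨c, -, rfl⟩ := Finset.mem_map.1 (he.symm ▸ hiS)
    refine (inf_valuation_le_plucker ν hint e c).trans ?_
    have hSe : (⟨Finset.univ.map e, by rw [Finset.card_map, Finset.card_fin]⟩ : Quad) = S :=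
      Subtype.ext he
    rw [hplucker e, hSe, hS, WithTop.coe_zero]

end PGL

/-! ### Blocks with the same picture are projectively equivalent -/

theorem Block.val_fst_nonneg (B : Block) (S : Quad) : 0 ≤ B.val.1 S := by
  simp only [Block.val, CayleyOctad.relabel, std_apply]
  exact Nat.cast_nonneg _

theorem Block.exists_val_fst_eq_zero (B : Block) (i : Fin 8) :
    ∃ S : Quad, i ∈ S.1 ∧ B.val.1 S = 0 := by
  have key : ∀ k : Kind, ∀ i : Fin 8, ∃ s ∈ masksOfCard 4, i ∈ labelsOf s ∧
      s < 256 ∧ (labelsOf s).card = 4 ∧ stdEntry k (fun m => bitCount (s &&& m)) = 0 := by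
    intro k
    cases k <;> decide +kernel
  obtain ⟨s, -, his, hs, hcard, hzero⟩ := key B.kind (B.label.symm i)
  refine ⟨⟨(labelsOf s).map B.label.toEmbedding, by rw [Finset.card_map, hcard]⟩,
    Finset.mem_map.2 ⟨_, his, B.label.apply_symm_apply i⟩, ?_⟩
  have hS : ((labelsOf s).map B.label.toEmbedding).map B.label.symm.toEmbedding = labelsOf s := by
    rw [Finset.map_map]
    convert Finset.map_refl
    ext i
    simp
  have hcount : (fun m => (labelsOf s ∩ labelsOf m).card) = fun m => bitCount (s &&& m) := by
    funext m
    rw [← labelsOf_and, card_labelsOf (lt_of_le_of_lt Nat.and_le_left hs)]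
  simp only [Block.val, CayleyOctad.relabel, std_apply, hS, hcount, hzero, Nat.cast_zero]

section

variable {L : Type*} [Field L] {ν : AddValuation L (WithTop ℚ)}

/-- The two blocks differ by a lineality vector, and every block has nonnegative entries and a zero
entry at some quadruple through each label, so `exists_isPluckerData_smul` applies in both
directions. -/
theorem pglEquivalent_of_picture_eq (hν : ∀ q : ℚ, ∃ y : L, ν y = q) {B B' : Block}
    (h : B.picture = B'.picture) : PGLEquivalent ν B.val B'.val := by
  have key : ∀ B B' : Block, B.picture = B'.picture → ∀ O : Octad L, IsPluckerData ν O B.val.1 →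
      ∃ g : LinearMap.GeneralLinearGroup L (Fin 4 → L),
        IsPluckerData ν (fun i => g • O i) B'.val.1 := by
    intro B B' h O hO
    obtain ⟨a, ha⟩ := B.exists_val_eq
    obtain ⟨a', ha'⟩ := B'.exists_val_eq
    refine exists_isPluckerData_smul hν (a := fun i => (a' i - a i) / 2) (fun S => ?_)
      B'.val_fst_nonneg B'.exists_val_fst_eq_zero hO
    rw [← Finset.sum_div, Finset.sum_sub_distrib]
    have h1 := ha S
    have h2 := ha' S
    rw [h] at h1
    linarith
  refine ⟨?_, key B B' h, key B' B h.symm⟩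
  rw [Block.val_snd, Block.val_snd, ← Block.picture_fst, ← Block.picture_fst, h]

theorem PGLEquivalent.trans {v v' v'' : ValData} (h : PGLEquivalent ν v v')
    (h' : PGLEquivalent ν v' v'') : PGLEquivalent ν v v'' := by
  have key : ∀ {w w' w'' : Quad → ℚ},
      (∀ O : Octad L, IsPluckerData ν O w → ∃ g : LinearMap.GeneralLinearGroup L (Fin 4 → L),
        IsPluckerData ν (fun i => g • O i) w') →
      (∀ O : Octad L, IsPluckerData ν O w' → ∃ g : LinearMap.GeneralLinearGroup L (Fin 4 → L),
        IsPluckerData ν (fun i => g • O i) w'') →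
      ∀ O : Octad L, IsPluckerData ν O w → ∃ g : LinearMap.GeneralLinearGroup L (Fin 4 → L),
        IsPluckerData ν (fun i => g • O i) w'' := by
    intro w w' w'' h h' O hO
    obtain ⟨g, hg⟩ := h O hO
    obtain ⟨g', hg'⟩ := h' _ hg
    refine ⟨g' * g, ?_⟩
    simp only [mul_smul]
    exact hg'
  exact ⟨h.1.trans h'.1, key h.2.1 h'.2.1, key h'.2.2 h.2.2⟩

open scoped Classical in
-- Each equivalence class of blocks is a union of full pictures, so membership in the class is a
-- function of the picture.
theorem classCoeff_eq_total (hν : ∀ q : ℚ, ∃ y : L, ν y = q) (f : Block →₀ ℚ) (B : Block) :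
    classCoeff ν f B = total f fun P =>
      if ∃ C : Block, C.picture = P ∧ PGLEquivalent ν C.val B.val then 1 else 0 := by
  rw [classCoeff, Finset.sum_filter]
  refine Finset.sum_congr rfl fun C _ => ?_
  have : (∃ D : Block, D.picture = C.picture ∧ PGLEquivalent ν D.val B.val) ↔
      PGLEquivalent ν C.val B.val :=
    ⟨fun ⟨_, hD, hDB⟩ => (pglEquivalent_of_picture_eq hν hD.symm).trans hDB,
      fun h => ⟨C, rfl, h⟩⟩
  simp only [this]
  split_ifs <;> simp

theorem total_eq_of_pictureCoeff_eq {f f' : Block →₀ ℚ}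
    (h : ∀ B : Block, pictureCoeff f B.picture = pictureCoeff f' B.picture) (u : Picture → ℤ) :
    total f u = total f' u := by
  set s := (f.support ∪ f'.support).image Block.picture with hs
  rw [total_eq_sum (s := s) u fun B hB => Finset.mem_image_of_mem _ (Finset.mem_union_left _ hB),
    total_eq_sum (s := s) u fun B hB => Finset.mem_image_of_mem _ (Finset.mem_union_right _ hB)]
  refine Finset.sum_congr rfl fun P hP => ?_
  obtain ⟨B, -, rfl⟩ := Finset.mem_image.1 hP
  exact congrArg _ (h B)

end

theorem IsNormalizedValuation.exists_eq {K : Type*} [Field K] [ValuativeRel K] [TopologicalSpace K]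
    [IsNonarchimedeanLocalField K] {ν : AddValuation (AlgebraicClosure K) (WithTop ℚ)}
    (hν : IsNormalizedValuation K ν) (q : ℚ) : ∃ y, ν y = q := by
  obtain ⟨ϖ, hϖ⟩ := IsDiscreteValuationRing.exists_irreducible 𝒪[K]
  have h1 := hν.uniformizer ϖ hϖ
  -- A root of the uniformiser of order `q.den` has valuation `1 / q.den`; its integral powers then
  -- reach `q`.
  obtain ⟨y, hy⟩ := IsAlgClosed.exists_pow_nat_eq
    (algebraMap K (AlgebraicClosure K) (ϖ : K)) q.pos
  have hyq : ∃ r : ℚ, ν y = r := by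
    refine (WithTop.ne_top_iff_exists.1 fun htop => ?_).imp fun _ => Eq.symm
    rw [ν.top_iff] at htop
    rw [← hy, htop, zero_pow q.den_nz, ν.map_zero] at h1
    exact absurd h1 (by simp)
  obtain ⟨r, hr⟩ := hyq
  have hrq : (q.den : ℚ) * r = 1 := by
    rw [← hy, ν.map_pow, hr, ← WithTop.coe_nsmul, nsmul_eq_mul] at h1
    exact_mod_cast h1
  have hpow : ∀ n : ℕ, ν (y ^ n) = ((n * r : ℚ) : WithTop ℚ) := fun n => by
    rw [ν.map_pow, hr, ← WithTop.coe_nsmul, nsmul_eq_mul]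
  have hq : q = q.num * r := by
    have hden : (q.den : ℚ) ≠ 0 := Nat.cast_ne_zero.2 q.den_nz
    rw [← mul_right_inj' hden, mul_left_comm, hrq, mul_one, mul_comm, Rat.mul_den_eq_num]
  have hy0 : y ≠ 0 := by
    rintro rfl
    rw [ν.map_zero] at hr
    exact WithTop.coe_ne_top hr.symm
  obtain ⟨n, hn | hn⟩ := q.num.eq_nat_or_neg
  · refine ⟨y ^ n, ?_⟩
    rw [hpow, hq, hn, Int.cast_natCast]
  · refine ⟨(y ^ n)⁻¹, ?_⟩
    have h := congrArg ν (inv_mul_cancel₀ (pow_ne_zero n hy0))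
    rw [ν.map_mul, hpow, ν.map_one] at h
    rw [hq, hn, Int.cast_neg, Int.cast_natCast]
    cases hz : ν (y ^ n)⁻¹ with
    | top => rw [hz, top_add] at h; exact absurd h (by simp)
    | coe z =>
      rw [hz, ← WithTop.coe_add, ← WithTop.coe_zero, WithTop.coe_inj] at h
      rw [WithTop.coe_inj]
      linarith

end CayleyOctad

end

/-- Uniqueness, up to `PGL₃(K̄)`-equivalence, of compatible block decompositions of the valuation
data of a Cayley octad. -/
theorem mainTheorem2 (K : Type*) [Field K] [ValuativeRel K] [TopologicalSpace K]
    [IsNonarchimedeanLocalField K] (hp : ringChar 𝓀[K] ≠ 2)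
    (ν : AddValuation (AlgebraicClosure K) (WithTop ℚ)) (hν : IsNormalizedValuation K ν)
    (O : Octad (AlgebraicClosure K)) (hO : IsCayleyOctad O)
    (v : ValData) (hv : IsValuationData ν O v)
    (m l m' l' : Block →₀ ℚ)
    (h : IsCompatibleBlockDecomposition v m l) (h' : IsCompatibleBlockDecomposition v m' l') :
    DecompositionsEquivalent ν m l m' l' := by
  intro B
  simp only [classCoeff_eq_total hν.exists_eq]
  exact ⟨total_eq_of_pictureCoeff_eq (fun C => (h.pictureCoeff_unique h' C).1) _,
    total_eq_of_pictureCoeff_eq (fun C => (h.pictureCoeff_unique h' C).2) _⟩
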